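/- Let $p$ be an odd prime, $\mathbb F$ a field of characteristic $p$, $E=\langle e_1,e_2,e_3,e_4\rangle\cong(\mathbb Z/p)^4$, and let $M=(c_{ij})\in\mathbb F^{2\times 4}$. Put $$\sigma(c_1,c_2)=\begin{pmatrix}1&2c_1&c_1^2+c_2\\0&1&c_1\\0&0&1\end{pmatrix}.$$ Let $V_M$ be the representation of $E$ given by $e_j\mapsto\sigma(c_{1j},c_{2j})$, so that $E$ acts on $\mathbb F[V_M]=\mathbb F[x,y,z]$ by algebra automorphisms extending right multiplication on the row vectors $x=[0\,0\,1]$, $y=[0\,1\,0]$, $z=[1\,0\,0]$. Let $\mathbb F[V_M]^E$ be the ring of invariants and $N_M(z)=\prod\{z\cdot g\mid g\in E\}$ the orbit product of $z$. Let $\Gamma$ be the $10\times4$ matrix whose rows $2k+1$ and $2k+2$ ($0\le k\le 4$) are the first and second row of the generic matrix $(x_{ij})\in\mathbb F_p(x_{ij})^{2\times4}$ with all entries raised to the power $p^k$, and let $\gamma_{ijk\ell}$ be its $4\times 4$ minor on rows $i,j,k,\ell$; write $\bar\gamma_{ijk\ell}=\gamma_{ijk\ell}(M)$ for its value at $M$.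 Let $\delta=y^2-xz$, and let $\widetilde\Gamma$ be $\Gamma$ augmented by a last column with entry $(y/x)^{p^k}$ in row $2k+1$ and $(-\delta/x^2)^{p^k}$ in row $2k+2$. For $J=(j_1<\dots<j_5)$ let $f_J$ be the $5\times5$ minor of $\widetilde\Gamma$ on rows $J$ multiplied by the least power of $x$ that clears its denominator, and let $\bar f_J\in\mathbb F[x,y,z]$ be obtained by evaluating the coefficients of $f_J$ at $M$. Suppose $\bar\gamma_{1234}=0$, $\bar\gamma_{1235}\ne0$ and $\bar\gamma_{1357}\ne0$. Define $$h_1=\frac{\bar f_{12345}}{\bar\gamma_{1235}\,x^{p^2-2p}},\qquad h_2=\frac{\bar f_{12357}}{\bar\gamma_{1235}},\qquad h_3=\frac{\bar\gamma_{1235}\,\widetilde h_3}{2\bar\gamma_{1357}\,x^{p^3-2}},$$ $$\widetilde h_3=h_2^2-h_1^{p^2}+2\frac{\bar\gamma_{1237}}{\bar\gamma_{1235}}h_1^{p(p+1)/2}x^{p^3-p^2}-2\frac{\bar\gamma_{1257}}{\bar\gamma_{1235}}h_1^{(p^2+1)/2}x^{p^3-p}.$$ Use the graded reverse lexicographic order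 with $x<y<z$. A finite subset $\mathcal B$ of a subalgebra $A\subseteq\mathbb F[x,y,z]$ is a SAGBI basis for $A$ if the lead monomials of the elements of $\mathcal B$ generate the lead term algebra of $A$. A non-trivial tête-à-tête is a pair of power products of elements of $\mathcal B$ with disjoint supports and the same lead monomial. Subducting a polynomial means repeatedly subtracting scalar multiples of power products of elements of $\mathcal B$ with the same lead term; a tête-à-tête $(b,b')$ subducts to zero if $b-cb'$ does, where $c\in\mathbb F$ is such that $b$ and $cb'$ have the same lead term, and it then yields a relation among the elements of $\mathcal B$. Then the divisions defining $h_1$ and $h_3$ are exact in $\mathbb F[x,y,z]$, and: 1. $\mathcal B=\{x,h_1,h_2,h_3,N_M(z)\}$ is a SAGBI basis, and hence a generating set, for $\mathbb F[V_M]^E$; its elements are nonzero and homogeneous of degrees $1,\,2p,\,p^3,\,p^3+2,\,p^4$ respectively. 2. $\mathbb F[V_M]^E$ is a complete intersection, that is, it has a presentation whose ideal of relations is generated by a regular sequence. More precisely, $(h_2^2,h_1^{p^2})$ and $(h_3^p,h_1h_2^p)$ are non-trivial têtes-à-têtes that subduct to zero using $\mathcal B$. For any relations $r_1,r_2\in\mathbb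 F[X_0,\dots,X_4]$ coming from such subductions, $(r_1,r_2)$ is a regular sequence that generates the kernel of $\mathbb F[X_0,\dots,X_4]\to\mathbb F[x,y,z]$, $(X_0,\dots,X_4)\mapsto(x,h_1,h_2,h_3,N_M(z))$; and $r_1,r_2$ are homogeneous of degrees $2p^3$ and $p^4+2p$ when $X_0,\dots,X_4$ have weights $1,2p,p^3,p^3+2,p^4$. -/

import Mathlib

open MvPolynomial

/-! ### The graded reverse lexicographic order on monomials in three variables

The polynomial ring `𝔽[x, y, z]` is `MvPolynomial (Fin 3) 𝔽` with `z = X 0`, `y = X 1`, `x = X 2`,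
so that `X 0, X 1, X 2` are the coordinate row vectors `[1 0 0], [0 1 0], [0 0 1]`. -/

/-- Exponent vectors of monomials in `z, y, x`, to be ordered by grevlex with `x < y < z`. -/
def GRevLex : Type := Fin 3 →₀ ℕ

namespace GRevLex

noncomputable instance : AddCommMonoid GRevLex :=
  inferInstanceAs (AddCommMonoid (Fin 3 →₀ ℕ))

/-- `(total degree, degree in z and y, degree in z)`, compared lexicographically. -/
def key (a : Fin 3 →₀ ℕ) : ℕ ×ₗ ℕ ×ₗ ℕ :=
  toLex (a 0 + a 1 + a 2, toLex (a 0 + a 1, a 0))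

theorem key_injective : Function.Injective key := by
  intro a b h
  simp only [key, EmbeddingLike.apply_eq_iff_eq, Prod.mk.injEq] at h
  ext i
  fin_cases i <;> simp <;> omega

theorem key_add (a b : Fin 3 →₀ ℕ) : key (a + b) = key a + key b := by
  have h : ∀ n : ℕ × ℕ × ℕ, ∀ m : ℕ × ℕ × ℕ, n = m →
      (toLex (n.1, toLex n.2) : ℕ ×ₗ ℕ ×ₗ ℕ) = toLex (m.1, toLex m.2) := by
    rintro n _ rfl
    rfl
  refine h (_, _, _) (_, _, _) ?_
  simp only [Finsupp.add_apply, Prod.mk.injEq]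
  refine ⟨?_, ?_, rfl⟩
  · change _ = (a 0 + a 1 + a 2) + (b 0 + b 1 + b 2)
    ring
  · change _ = (a 0 + a 1) + (b 0 + b 1)
    ring

noncomputable instance : LinearOrder GRevLex :=
  LinearOrder.lift' (key : GRevLex → ℕ ×ₗ ℕ ×ₗ ℕ) key_injective

theorem le_iff_key (a b : GRevLex) : a ≤ b ↔ key a ≤ key b := Iff.rfl

theorem lt_iff_key (a b : GRevLex) : a < b ↔ key a < key b := Iff.rfl

instance : IsOrderedAddMonoid GRevLex where
  add_le_add_left a b h c := by
    rw [le_iff_key] at h ⊢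
    have h1 : key (a + c) = key a + key c := key_add a c
    have h2 : key (b + c) = key b + key c := key_add b c
    rw [h1, h2]
    gcongr

instance : WellFoundedLT GRevLex :=
  ⟨InvImage.wf (key : GRevLex → ℕ ×ₗ ℕ ×ₗ ℕ) wellFounded_lt⟩

end GRevLex

/-- The graded reverse lexicographic order with `x < y < z`. -/
noncomputable def grevlex : MonomialOrder (Fin 3) where
  syn := GRevLex
  toSyn :=
    { toEquiv := (Equiv.refl (Fin 3 →₀ ℕ) : (Fin 3 →₀ ℕ) ≃ GRevLex)
      map_add' := fun _ _ => rfl }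
  toSyn_monotone := by
    intro a b h
    have h0 := h 0
    have h1 := h 1
    have h2 := h 2
    change GRevLex.key a ≤ GRevLex.key b
    simp only [GRevLex.key, Prod.Lex.toLex_le_toLex]
    omega

/-- The usual description: compare degrees first; in equal degree, the monomial with the smaller
exponent of `x` is larger, and then the one with the smaller exponent of `y`. -/
theorem grevlex_lt_iff (a b : Fin 3 →₀ ℕ) :
    grevlex.toSyn a < grevlex.toSyn b ↔
      a 0 + a 1 + a 2 < b 0 + b 1 + b 2 ∨
        (a 0 + a 1 + a 2 = b 0 + b 1 + b 2 ∧ (b 2 < a 2 ∨ (b 2 = a 2 ∧ b 1 < a 1))) := by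
  change GRevLex.key a < GRevLex.key b ↔ _
  simp only [GRevLex.key, Prod.Lex.toLex_lt_toLex]
  omega

/-! ### SAGBI bases, subduction, complete intersections -/

section Sagbi

variable {F : Type*} [Field F]

/-- The lead monomial of a polynomial (used for nonzero polynomials). -/
noncomputable def leadMonomial (f : MvPolynomial (Fin 3) F) : MvPolynomial (Fin 3) F :=
  monomial (grevlex.degree f) 1

/-- The lead monomials of the nonzero elements of a set of polynomials. -/
def leadMonomials (S : Set (MvPolynomial (Fin 3) F)) : Set (MvPolynomial (Fin 3) F) :=
  {m | ∃ f ∈ S, f ≠ 0 ∧ m = leadMonomial f}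

/-- `B ⊆ A` is a SAGBI basis for the subalgebra `A`: the lead monomials of the elements of `B`
generate the lead term algebra of `A`. -/
def IsSagbiBasis (B : Set (MvPolynomial (Fin 3) F)) (A : Subalgebra F (MvPolynomial (Fin 3) F)) :
    Prop :=
  B ⊆ A ∧ Algebra.adjoin F (leadMonomials B) = Algebra.adjoin F (leadMonomials A)

/-- The power product `h^I`. -/
noncomputable def powerProduct {ℓ : ℕ} (h : Fin ℓ → MvPolynomial (Fin 3) F) (I : Fin ℓ →₀ ℕ) :
    MvPolynomial (Fin 3) F :=
  ∏ i, h i ^ I i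

/-- `(h^I, h^J)` is a non-trivial tête-à-tête. -/
def IsNontrivialTat {ℓ : ℕ} (h : Fin ℓ → MvPolynomial (Fin 3) F) (I J : Fin ℓ →₀ ℕ) : Prop :=
  leadMonomial (powerProduct h I) = leadMonomial (powerProduct h J) ∧ Disjoint I.support J.support

/-- `f` subducts to zero using the family `h`, where `P` is the resulting expression of `f` as a
polynomial in the `h i`: as long as `f` is not zero, subtract some `c * h^I` with the same lead term
as `f`. -/
inductive SubductsToZero {ℓ : ℕ} (h : Fin ℓ → MvPolynomial (Fin 3) F) :
    MvPolynomial (Fin 3) F → MvPolynomial (Fin ℓ) F → Prop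
  | zero : SubductsToZero h 0 0
  | step (f : MvPolynomial (Fin 3) F) (I : Fin ℓ →₀ ℕ) (c : F) (P : MvPolynomial (Fin ℓ) F)
      (hf : f ≠ 0) (hlt : grevlex.leadingTerm f = grevlex.leadingTerm (C c * powerProduct h I))
      (hP : SubductsToZero h (f - C c * powerProduct h I) P) :
      SubductsToZero h f (monomial I c + P)

/-- `r` is a relation coming from the subduction to zero of the tête-à-tête `(h^I, h^J)`: for the
scalar `c` for which the lead terms of `h^I` and `c * h^J` agree, `h^I - c * h^J` subducts to zero
with resulting expression `P`, and `r` is the relation `X^I - c * X^J - P`. -/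
def IsTatRelation {ℓ : ℕ} (h : Fin ℓ → MvPolynomial (Fin 3) F) (I J : Fin ℓ →₀ ℕ)
    (r : MvPolynomial (Fin ℓ) F) : Prop :=
  ∃ (c : F) (P : MvPolynomial (Fin ℓ) F),
    grevlex.leadingTerm (powerProduct h I) = grevlex.leadingTerm (C c * powerProduct h J) ∧
    SubductsToZero h (powerProduct h I - C c * powerProduct h J) P ∧
    r = monomial I 1 - monomial J c - P

/-- The algebra `A` has a presentation for which the ideal of relations is generated by a regular
sequence. -/
def IsCompleteIntersection (F A : Type*) [Field F] [CommRing A] [Algebra F A] : Prop :=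
  ∃ (n : ℕ) (φ : MvPolynomial (Fin n) F →ₐ[F] A) (rs : List (MvPolynomial (Fin n) F)),
    Function.Surjective φ ∧
    RingTheory.Sequence.IsRegular (MvPolynomial (Fin n) F) rs ∧
    RingHom.ker φ = Ideal.ofList rs

end Sagbi

/-! ### The representation `V_M` and its invariants -/

section Representation

variable {F : Type*} [Field F]

/-- The matrix `σ(c₁, c₂)`. -/
def sigmaMatrix (c₁ c₂ : F) : Matrix (Fin 3) (Fin 3) F :=
  !![1, 2 * c₁, c₁ ^ 2 + c₂; 0, 1, c₁; 0, 0, 1]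

theorem sigmaMatrix_zero : sigmaMatrix (0 : F) 0 = 1 := by
  ext i j
  fin_cases i <;> fin_cases j <;> simp [sigmaMatrix]

theorem sigmaMatrix_add (c₁ c₂ d₁ d₂ : F) :
    sigmaMatrix (c₁ + d₁) (c₂ + d₂) = sigmaMatrix c₁ c₂ * sigmaMatrix d₁ d₂ := by
  ext i j
  fin_cases i <;> fin_cases j <;>
    simp [sigmaMatrix, Matrix.mul_apply, Fin.sum_univ_three] <;> ring

variable (p : ℕ) [CharP F p]

/-- For `a = (a₁, …, a₄) ∈ 𝔽_p⁴`, the `𝔽_p`-linear combination `∑ j, a_j c_{ij}` of the entries of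
row `i` of `M`. -/
def rowComb (M : Matrix (Fin 2) (Fin 4) F) (i : Fin 2) (a : Fin 4 → ZMod p) : F :=
  ∑ j, ZMod.castHom (dvd_refl p) F (a j) * M i j

/-- The representation `V_M` of `E = (ℤ/p)⁴` (written multiplicatively), which sends the `j`-th
generator `e_j` to `σ(c_{1j}, c_{2j})`. -/
def repV (M : Matrix (Fin 2) (Fin 4) F) :
    Multiplicative (Fin 4 → ZMod p) →* Matrix (Fin 3) (Fin 3) F where
  toFun e := sigmaMatrix (rowComb p M 0 e.toAdd) (rowComb p M 1 e.toAdd)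
  map_one' := by simp [rowComb, sigmaMatrix_zero]
  map_mul' a b := by
    rw [← sigmaMatrix_add]
    simp only [rowComb, toAdd_mul, Pi.add_apply, map_add, add_mul, Finset.sum_add_distrib]

/-- The generator `e_j` acts by `σ(c_{1j}, c_{2j})`. -/
theorem repV_generator (M : Matrix (Fin 2) (Fin 4) F) (j : Fin 4) :
    repV p M (Multiplicative.ofAdd (Pi.single j 1)) = sigmaMatrix (M 0 j) (M 1 j) := by
  have key : ∀ i, rowComb p M i (Pi.single j 1) = M i j := by
    intro i
    rw [rowComb, Finset.sum_eq_single j]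
    · rw [Pi.single_eq_same, map_one, one_mul]
    · intro k _ hk
      rw [Pi.single_eq_of_ne hk, map_zero, zero_mul]
    · simp
  change sigmaMatrix (rowComb p M 0 (Pi.single j 1)) (rowComb p M 1 (Pi.single j 1)) = _
  rw [key, key]

/-- The action of `e ∈ E` on `𝔽[x, y, z]`: the algebra automorphism that extends right
multiplication of the coordinate row vectors by the matrix of `e`. -/
noncomputable def act (M : Matrix (Fin 2) (Fin 4) F) (e : Multiplicative (Fin 4 → ZMod p)) :
    MvPolynomial (Fin 3) F →ₐ[F] MvPolynomial (Fin 3) F :=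
  aeval fun i => ∑ k, C (repV p M e i k) * X k

/-- The ring of invariants `𝔽[V_M]^E`. -/
noncomputable def invariants (M : Matrix (Fin 2) (Fin 4) F) :
    Subalgebra F (MvPolynomial (Fin 3) F) :=
  ⨅ e, AlgHom.equalizer (act p M e) (AlgHom.id F (MvPolynomial (Fin 3) F))

theorem mem_invariants (M : Matrix (Fin 2) (Fin 4) F) (f : MvPolynomial (Fin 3) F) :
    f ∈ invariants p M ↔ ∀ e, act p M e f = f := by
  simp [invariants, Algebra.mem_iInf, AlgHom.mem_equalizer]

open Classical in
/-- The norm `N_M(f)`: the product over the orbit `{f · g | g ∈ E}`. -/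
noncomputable def normM [Fact p.Prime] (M : Matrix (Fin 2) (Fin 4) F)
    (f : MvPolynomial (Fin 3) F) : MvPolynomial (Fin 3) F :=
  ∏ q ∈ Finset.univ.image (fun e : Multiplicative (Fin 4 → ZMod p) => act p M e f), q

end Representation

/-! ### The minors `γ_{ijkℓ}(M)`, the invariants `f̄_J`, and `h₁`, `h₂`, `h₃` -/

section Generators

variable {F : Type*} [Field F] (p : ℕ)

/-- Row `i = 1, 2, 3, …` of the matrix `Γ` evaluated at `M`: the rows `2k + 1` and `2k + 2` are the
first and second row of `M` with all entries raised to the power `p ^ k`. -/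
def gammaRow (M : Matrix (Fin 2) (Fin 4) F) (i : ℕ) (j : Fin 4) : F :=
  (if Odd i then M 0 j else M 1 j) ^ p ^ ((i - 1) / 2)

/-- The minor `γ_I(M)` of the rows `I = (i, j, k, ℓ)` of `Γ`. -/
def gam (M : Matrix (Fin 2) (Fin 4) F) (I : Fin 4 → ℕ) : F :=
  (Matrix.of fun a => gammaRow p M (I a)).det

/-- `δ = y² - x z`. -/
noncomputable def delta : MvPolynomial (Fin 3) F := X 1 ^ 2 - X 2 * X 0

/-- The additional column of `Γ̃` has entry `(y/x)^(p^k)` in row `2k + 1` and `(-δ/x²)^(p^k)` in row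
`2k + 2`. This is the exponent of `x` in the denominator of row `i`. -/
def denomExp (i : ℕ) : ℕ := (if Odd i then 1 else 2) * p ^ ((i - 1) / 2)

/-- The numerator of the entry of the additional column of `Γ̃` in row `i`. -/
noncomputable def numer (i : ℕ) : MvPolynomial (Fin 3) F :=
  (if Odd i then X 1 else -delta) ^ p ^ ((i - 1) / 2)

/-- The power of `x` that minimally clears the denominator of the generic minor `f̃_J`. (The minors
`γ` are nonzero for the generic matrix, so this is the largest exponent in the denominators of the
entries.) -/
def clearExp (J : Fin 5 → ℕ) : ℕ := Finset.univ.sup fun a => denomExp p (J a)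

/-- `f̄_J`: the minor of `Γ̃` for the rows `J`, with the denominator of the generic minor cleared (by
multiplying the last column by a power of `x`) and with coefficients evaluated at `M`. -/
noncomputable def fBar (M : Matrix (Fin 2) (Fin 4) F) (J : Fin 5 → ℕ) : MvPolynomial (Fin 3) F :=
  (Matrix.of fun a : Fin 5 =>
    (Fin.snoc (fun j => C (gammaRow p M (J a) j))
      (X 2 ^ (clearExp p J - denomExp p (J a)) * numer p (J a)) :
      Fin 5 → MvPolynomial (Fin 3) F)).det

/-- The quotient of `f` by `x ^ n` (meant for `f` divisible by `x ^ n`). -/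
noncomputable def divXPow (n : ℕ) (f : MvPolynomial (Fin 3) F) : MvPolynomial (Fin 3) F :=
  f.divMonomial (Finsupp.single 2 n)

variable (M : Matrix (Fin 2) (Fin 4) F)

/-- `h₁ = f̄₁₂₃₄₅ / (γ₁₂₃₅ x^(p²-2p))`. -/
noncomputable def genH1 : MvPolynomial (Fin 3) F :=
  divXPow (p ^ 2 - 2 * p) (C (gam p M ![1, 2, 3, 5])⁻¹ * fBar p M ![1, 2, 3, 4, 5])

/-- `h₂ = f̄₁₂₃₅₇ / γ₁₂₃₅`. -/
noncomputable def genH2 : MvPolynomial (Fin 3) F :=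
  C (gam p M ![1, 2, 3, 5])⁻¹ * fBar p M ![1, 2, 3, 5, 7]

/-- `h̃₃ = h₂² - h₁^(p²) + 2 (γ₁₂₃₇/γ₁₂₃₅) h₁^(p(p+1)/2) x^(p³-p²)
  - 2 (γ₁₂₅₇/γ₁₂₃₅) h₁^((p²+1)/2) x^(p³-p)`. -/
noncomputable def genH3Tilde : MvPolynomial (Fin 3) F :=
  genH2 p M ^ 2 - genH1 p M ^ p ^ 2
    + C (2 * (gam p M ![1, 2, 3, 7] / gam p M ![1, 2, 3, 5])) *
        genH1 p M ^ (p * (p + 1) / 2) * X 2 ^ (p ^ 3 - p ^ 2)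
    - C (2 * (gam p M ![1, 2, 5, 7] / gam p M ![1, 2, 3, 5])) *
        genH1 p M ^ ((p ^ 2 + 1) / 2) * X 2 ^ (p ^ 3 - p)

/-- `h₃ = γ₁₂₃₅ h̃₃ / (2 γ₁₃₅₇ x^(p³-2))`. -/
noncomputable def genH3 : MvPolynomial (Fin 3) F :=
  divXPow (p ^ 3 - 2)
    (C (gam p M ![1, 2, 3, 5] / (2 * gam p M ![1, 3, 5, 7])) * genH3Tilde p M)

/-- The family `x, h₁, h₂, h₃, N_M(z)`. -/
noncomputable def gens [Fact p.Prime] [CharP F p] : Fin 5 → MvPolynomial (Fin 3) F :=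
  ![X 2, genH1 p M, genH2 p M, genH3 p M, normM p M (X 0)]

end Generators

/-! In the coordinates u = y/x, v = -δ/x² the group acts by translations: e adds r₀(e) to u and
r₁(e) to v, where r₀, r₁ are the 𝔽_p-combinations `rowComb` of the two rows of M. Expanding the
minors along the last column turns h₁ and h₂ into homogenizations of additive polynomials A = -v^p +
αu^p + βv + εu and B = u^(p³) - au^(p²) + bu^p - cv + du. Both vanish at every (r₀(e), r₁(e)),
because the extra column then depends linearly on the others, so both are invariant. The condition
γ₁₂₃₄ = 0 removes u^(p²) from A, and γ₁₃₅₇ ≠ 0 says c ≠ 0.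

After setting x = 1, v can be eliminated through B, so that F[u, v] = F[B][u] and E acts only by u ↦
u + r₀(e), with r₀ injective. The monic additive polynomial Q = B^p - c^(p-1)βB - c^pA in u has
degree p⁴ = |E| and the values r₀(e) as its roots, so the invariants are F[B][Q] = F[A, B]
(`dehomog_mem_adjoin`).

To return to homogeneous invariants, call a power product normal if h₂ occurs at most once and h₃ at
most p - 1 times. The lead monomials of x, h₁, h₂, h₃, N_M(z) are x, y^(2p), y^(p³), y^(p³+2),
z^(p⁴); the one of h₃ comes from the cancellation in `exists_tatRemainder_eq`. Normal power products
have distinct lead monomials (`injOn_sum_smul_genDegree`), so their combinations never cancel at the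
top (`exists_degree_aeval`). After x = 1 the normal products without x have each monomial
v^(pi)u^(p³j) as a lead monomial; these are all the lead monomials of F[A, B], whence x^k f is a
normal combination for every homogeneous invariant f. The factor x is then cancelled step by step
(`exists_of_X_mul_eq`), since a nonzero combination of normal products without x has a lead monomial
free of x. Hence the normal power products form a basis of the invariants, and the SAGBI property
follows.

For the presentation, an order on F[X₀, …, X₄] refining that of the lead monomials gives the two
relations the lead monomials X₂² and X₃^p (`tatRelation_spec`). Division by them leaves a normal
remainder, which vanishes if it maps to 0 (`ker_aeval`); coprimality of X₂² and X₃^p gives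
regularity (`isRegular_pair`). -/

/-! ### Lead terms and their cancellation. -/

section MonomialOrderLemmas

variable {σ F : Type*} [Field F] (m : MonomialOrder σ)

/-- Subtracting a polynomial with the same lead monomial, suitably scaled, lowers the degree. -/
theorem degree_sub_lt_of_leadingTerm_eq {f g : MvPolynomial σ F}
    (h : m.leadingTerm f = m.leadingTerm g) (hne : f - g ≠ 0) :
    m.toSyn (m.degree (f - g)) < m.toSyn (m.degree f) := by
  have hd : m.degree f = m.degree g := by
    rw [← m.degree_leadingTerm f, h, m.degree_leadingTerm]
  have hc : m.leadingCoeff f = m.leadingCoeff g := by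
    rw [← m.leadingCoeff_leadingTerm f, h, m.leadingCoeff_leadingTerm]
  refine lt_of_le_of_ne ?_ ?_
  · refine m.degree_sub_le.trans ?_
    rw [hd, sup_idem]
  · intro he
    have he' := m.toSyn.injective he
    have : (f - g).coeff (m.degree (f - g)) = 0 := by
      rw [he', coeff_sub]
      nth_rewrite 2 [hd]
      exact sub_eq_zero.mpr hc
    exact hne (m.coeff_degree_eq_zero_iff.mp this)

theorem leadingTerm_C_mul (c : F) (g : MvPolynomial σ F) :
    m.leadingTerm (C c * g) = C c * m.leadingTerm g := by
  rw [m.leadingTerm_mul, m.leadingTerm_C]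

theorem leadingTerm_eq_of_degree_eq {f g : MvPolynomial σ F} (hg : g ≠ 0)
    (h : m.degree f = m.degree g) :
    m.leadingTerm f = m.leadingTerm (C (m.leadingCoeff f / m.leadingCoeff g) * g) := by
  rw [leadingTerm_C_mul, MonomialOrder.leadingTerm, MonomialOrder.leadingTerm, C_mul_monomial, h,
    div_mul_cancel₀ _ (m.leadingCoeff_ne_zero_iff.mpr hg)]

end MonomialOrderLemmas

/-! ### Power products and their lead monomials. -/

section PowerProduct

variable {F : Type*} [Field F] {ℓ : ℕ} (h : Fin ℓ → MvPolynomial (Fin 3) F)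

theorem powerProduct_add (I J : Fin ℓ →₀ ℕ) :
    powerProduct h (I + J) = powerProduct h I * powerProduct h J := by
  simp [powerProduct, pow_add, Finset.prod_mul_distrib]

theorem powerProduct_single (i : Fin ℓ) (n : ℕ) :
    powerProduct h (Finsupp.single i n) = h i ^ n := by
  classical
  rw [powerProduct, Finset.prod_eq_single i] <;> simp +contextual [eq_comm]

theorem powerProduct_ne_zero (hne : ∀ i, h i ≠ 0) (I : Fin ℓ →₀ ℕ) : powerProduct h I ≠ 0 :=
  Finset.prod_ne_zero_iff.mpr fun i _ => pow_ne_zero _ (hne i)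

theorem aeval_monomial_eq_powerProduct (I : Fin ℓ →₀ ℕ) (c : F) :
    aeval h (monomial I c) = C c * powerProduct h I := by
  rw [aeval_monomial, Finsupp.prod_fintype _ _ fun i => pow_zero _]
  rfl

theorem degree_powerProduct (m : MonomialOrder (Fin 3)) (hne : ∀ i, h i ≠ 0) (I : Fin ℓ →₀ ℕ) :
    m.degree (powerProduct h I) = ∑ i, I i • m.degree (h i) := by
  rw [powerProduct, m.degree_prod fun i _ => pow_ne_zero _ (hne i)]
  simp [m.degree_pow]

theorem isHomogeneous_powerProduct {w : Fin ℓ → ℕ} (hw : ∀ i, (h i).IsHomogeneous (w i))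
    (I : Fin ℓ →₀ ℕ) : (powerProduct h I).IsHomogeneous (Finsupp.weight w I) := by
  have := IsHomogeneous.prod Finset.univ (fun i => h i ^ I i) (fun i => w i * I i)
    fun i _ => (hw i).pow _
  rw [Finsupp.weight_apply, Finsupp.sum_fintype _ _ (by simp)]
  simpa [powerProduct, mul_comm] using this

theorem leadingCoeff_powerProduct (m : MonomialOrder (Fin 3)) (hne : ∀ i, m.Monic (h i))
    (I : Fin ℓ →₀ ℕ) : m.leadingCoeff (powerProduct h I) = 1 := by
  rw [powerProduct, m.leadingCoeff_prod_of_regular]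
  · simp [m.leadingCoeff_pow, (hne _).leadingCoeff_eq_one]
  · intro i _
    simp [m.leadingCoeff_pow, (hne _).leadingCoeff_eq_one, isRegular_one]

theorem aeval_eq_sum_powerProduct (P : MvPolynomial (Fin ℓ) F) :
    aeval h P = ∑ I ∈ P.support, C (P.coeff I) * powerProduct h I := by
  conv_lhs => rw [P.as_sum, map_sum]
  simp only [aeval_monomial_eq_powerProduct]

/-- If the power products of exponents in `S` have pairwise distinct lead monomials, then in a linear
combination of them no cancellation of the largest lead monomial occurs. -/
theorem exists_degree_aeval (m : MonomialOrder (Fin 3)) (hne : ∀ i, h i ≠ 0)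
    {S : Set (Fin ℓ →₀ ℕ)} (hinj : Set.InjOn (fun I => m.degree (powerProduct h I)) S)
    {P : MvPolynomial (Fin ℓ) F} (hP : P ≠ 0) (hS : P ∈ restrictSupport F S) :
    ∃ I ∈ P.support, m.degree (aeval h P) = m.degree (powerProduct h I) ∧ aeval h P ≠ 0 := by
  classical
  rw [mem_restrictSupport_iff] at hS
  obtain ⟨i, hi, hmax⟩ := P.support.exists_max_image
    (fun I => m.toSyn (m.degree (powerProduct h I))) (support_nonempty.mpr hP)
  refine ⟨i, hi, ?_⟩
  have hcoeff : (aeval h P).coeff (m.degree (powerProduct h i)) =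
      P.coeff i * m.leadingCoeff (powerProduct h i) := by
    rw [aeval_eq_sum_powerProduct, coeff_sum, Finset.sum_eq_single i]
    · simp [MonomialOrder.leadingCoeff]
    · intro j hj hji
      rw [coeff_C_mul, m.coeff_eq_zero_of_lt, mul_zero]
      exact lt_of_le_of_ne (hmax j hj) fun h => hji (hinj (hS hj) (hS hi) (m.toSyn.injective h))
    · intro h
      exact absurd hi h
  have hne' : (aeval h P).coeff (m.degree (powerProduct h i)) ≠ 0 := by
    rw [hcoeff]
    exact mul_ne_zero (mem_support_iff.mp hi)
      (m.leadingCoeff_ne_zero_iff.mpr (powerProduct_ne_zero h hne i))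
  have hle : m.toSyn (m.degree (aeval h P)) ≤ m.toSyn (m.degree (powerProduct h i)) := by
    rw [aeval_eq_sum_powerProduct]
    refine m.degree_sum_le.trans (Finset.sup_le fun j hj => ?_)
    rw [C_mul']
    exact (m.degree_smul_le).trans (hmax j hj)
  refine ⟨m.toSyn.injective (le_antisymm hle (m.le_degree (mem_support_iff.mpr hne'))), ?_⟩
  rintro h
  rw [h] at hne'
  exact hne' (coeff_zero _)

end PowerProduct

/-! ### Homogeneous polynomials in x, y, z. -/

section Homogeneous

variable {F : Type*} [Field F]

/-- For a homogeneous polynomial that is `y ^ n` modulo `x`, the lead monomial is `y ^ n`. -/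
theorem grevlex_degree_eq_of_X_dvd {f : MvPolynomial (Fin 3) F} {n : ℕ} (hf : f.IsHomogeneous n)
    (hdvd : (X 2 : MvPolynomial (Fin 3) F) ∣ f - X 1 ^ n) :
    grevlex.degree f = Finsupp.single 1 n ∧ grevlex.Monic f := by
  obtain ⟨g, hg⟩ := hdvd
  have hcoeff : ∀ d : Fin 3 →₀ ℕ, d 2 = 0 → f.coeff d = (X 1 ^ n : MvPolynomial (Fin 3) F).coeff d := by
    intro d hd
    have : (X 2 * g).coeff d = 0 := by
      rw [coeff_X_mul', if_neg (by simpa using hd)]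
    rw [← hg, coeff_sub] at this
    exact sub_eq_zero.mp this
  have h1 : f.coeff (Finsupp.single 1 n) = 1 := by
    rw [hcoeff _ (by simp), X_pow_eq_monomial, coeff_monomial, if_pos rfl]
  have hd : grevlex.degree f = Finsupp.single 1 n := by
    apply grevlex.toSyn.injective
    refine le_antisymm ?_ (grevlex.le_degree (by rw [mem_support_iff, h1]; exact one_ne_zero))
    rw [grevlex.degree_le_iff]
    intro d hd
    have hdeg := hf (mem_support_iff.mp hd)
    rw [Finsupp.weight_apply, Finsupp.sum_fintype _ _ (by simp), Fin.sum_univ_three] at hdeg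
    simp only [Pi.one_apply, smul_eq_mul, mul_one] at hdeg
    rw [← not_lt, grevlex_lt_iff]
    -- In fixed total degree any positive exponent of x makes a monomial smaller than `y ^ n`;
    -- without x only `y ^ n` itself can occur.
    by_cases h2 : d 2 = 0
    · have := mem_support_iff.mp hd
      rw [hcoeff d h2, X_pow_eq_monomial, coeff_monomial] at this
      have h3 : Finsupp.single 1 n = d := by
        by_contra h
        exact this (if_neg h)
      rw [← h3]
      simp
    · simp
      omega
  refine ⟨hd, ?_⟩
  rw [MonomialOrder.Monic, MonomialOrder.leadingCoeff, hd, h1]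

theorem isHomogeneous_of_X_pow_mul {i : Fin 3} {n d : ℕ} {g : MvPolynomial (Fin 3) F}
    (h : (X i ^ n * g).IsHomogeneous (n + d)) : g.IsHomogeneous d := by
  intro m hm
  have h1 : (X i ^ n * g).coeff (Finsupp.single i n + m) ≠ 0 := by
    rwa [X_pow_eq_monomial, coeff_monomial_mul, one_mul]
  have h2 := h h1
  rw [map_add, Finsupp.weight_single] at h2
  simpa using h2

theorem aeval_mul_of_isHomogeneous {A : Type*} [CommRing A] [Algebra F A]
    {f : MvPolynomial (Fin 3) F} {n : ℕ} (hf : f.IsHomogeneous n) (c : A) (a : Fin 3 → A) :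
    aeval (fun i => c * a i) f = c ^ n * aeval a f := by
  rw [aeval_def, aeval_def, eval₂_eq', eval₂_eq', Finset.mul_sum]
  refine Finset.sum_congr rfl fun d hd => ?_
  have hdeg := hf (mem_support_iff.mp hd)
  rw [Finsupp.weight_apply, Finsupp.sum_fintype _ _ (by simp), Fin.sum_univ_three] at hdeg
  simp only [Pi.one_apply, smul_eq_mul, mul_one] at hdeg
  rw [Fin.prod_univ_three, Fin.prod_univ_three, ← hdeg]
  ring

/-- A homogeneous polynomial that vanishes after setting `x = 1` (and `z ↦ z + y²`) is zero. -/
theorem eq_zero_of_dehomogenize_eq_zero {f : MvPolynomial (Fin 3) F} {n : ℕ}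
    (hf : f.IsHomogeneous n)
    (h : aeval ![X 0 + X 1 ^ 2, X 1, 1] f = (0 : MvPolynomial (Fin 3) F)) : f = 0 := by
  let K := FractionRing (MvPolynomial (Fin 3) F)
  let ι := algebraMap (MvPolynomial (Fin 3) F) K
  have hι : Function.Injective ι := IsFractionRing.injective _ _
  have hx : ι (X 2) ≠ 0 := by
    rw [Ne, map_eq_zero_iff ι hι]
    exact X_ne_zero 2
  -- η undoes the shift z ↦ z + y² and rescales, so that the composite evaluates f at (z/x, y/x, 1),
  -- which is x^(-n) f by homogeneity.
  let η : MvPolynomial (Fin 3) F →ₐ[F] K :=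
    aeval ![ι (X 0) / ι (X 2) - (ι (X 1) / ι (X 2)) ^ 2, ι (X 1) / ι (X 2), 1]
  have h1 : η.comp (aeval ![X 0 + X 1 ^ 2, X 1, 1]) = aeval fun i => ι (X i) / ι (X 2) := by
    ext i
    fin_cases i <;> simp [η, hx]
  have h2 : aeval (fun i => ι (X i) / ι (X 2)) f = 0 := by
    rw [← h1, AlgHom.comp_apply, h, map_zero]
  have h3 : ι f = ι (X 2) ^ n * aeval (fun i => ι (X i) / ι (X 2)) f := by
    have h4 : ι f = aeval (fun i => ι (X i)) f := by
      change algebraMap _ K f = _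
      have : (IsScalarTower.toAlgHom F (MvPolynomial (Fin 3) F) K) = aeval fun i => ι (X i) := by
        ext i
        simp [ι]
      rw [← this]
      rfl
    rw [h4, ← aeval_mul_of_isHomogeneous hf]
    congr
    ext i
    rw [mul_div_cancel₀ _ hx]
  rw [h2, mul_zero] at h3
  exact (map_eq_zero_iff ι hι).mp h3

end Homogeneous

/-! ### Expansion of the minors and the 𝔽_p-combinations of columns. -/

section Minors

variable {F : Type*} [Field F] (p : ℕ)

theorem fBar_eq_sum (M : Matrix (Fin 2) (Fin 4) F) (J : Fin 5 → ℕ) :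
    fBar p M J = ∑ a : Fin 5, (-1) ^ (a : ℕ) *
      (X 2 ^ (clearExp p J - denomExp p (J a)) * numer p (J a)) *
        C (gam p M (J ∘ a.succAbove)) := by
  rw [fBar, Matrix.det_succ_column _ (Fin.last 4)]
  refine Finset.sum_congr rfl fun a _ => ?_
  congr 1
  · rw [Matrix.of_apply, Fin.snoc_last, Fin.val_last, pow_add]
    norm_num
  · rw [gam, RingHom.map_det]
    congr 1
    ext1 i j
    simp only [Matrix.submatrix_apply, Fin.succAbove_last, Matrix.of_apply, Fin.snoc_castSucc,
      RingHom.mapMatrix_apply, Matrix.map_apply, Function.comp_apply]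

/-- The expansion along the last column of a matrix whose last column is a combination of the
others. -/
theorem sum_gam_mul_eq_zero (M : Matrix (Fin 2) (Fin 4) F) (J : Fin 5 → ℕ) (v : Fin 4 → F) :
    ∑ a : Fin 5, (-1) ^ (a : ℕ) * (∑ j, gammaRow p M (J a) j * v j) *
      gam p M (J ∘ a.succAbove) = 0 := by
  let A : Matrix (Fin 5) (Fin 5) F := Matrix.of fun a => Fin.snoc (fun j => gammaRow p M (J a) j)
    (∑ j, gammaRow p M (J a) j * v j)
  have hA : A.det = 0 := by
    rw [← Matrix.exists_mulVec_eq_zero_iff]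
    -- The vector (v, -1) records the linear dependence of the last column on the others.
    refine ⟨Fin.snoc v (-1), ?_, ?_⟩
    · intro h
      have := congrFun h (Fin.last 4)
      rw [Fin.snoc_last] at this
      simp at this
    · ext a
      simp only [A, Matrix.mulVec, dotProduct]
      rw [Fin.sum_univ_castSucc]
      simp only [Matrix.of_apply, Fin.snoc_castSucc, Fin.snoc_last, Pi.zero_apply]
      ring
  rw [← hA, Matrix.det_succ_column _ (Fin.last 4)]
  refine Finset.sum_congr rfl fun a _ => ?_
  congr 1
  · simp only [A]
    rw [Matrix.of_apply, Fin.snoc_last, Fin.val_last, pow_add]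
    norm_num

variable [Fact p.Prime] [CharP F p]

/-- Frobenius is additive and fixes the coefficients in 𝔽_p, so forming the combination commutes
with taking p^k-th powers. -/
theorem sum_gammaRow_mul (M : Matrix (Fin 2) (Fin 4) F) (i : ℕ) (a : Fin 4 → ZMod p) :
    ∑ j, gammaRow p M i j * ZMod.castHom (dvd_refl p) F (a j) =
      (if Odd i then rowComb p M 0 a else rowComb p M 1 a) ^ p ^ ((i - 1) / 2) := by
  have h : ∀ (k : ℕ) (x : ZMod p),
      ZMod.castHom (dvd_refl p) F x = ZMod.castHom (dvd_refl p) F x ^ p ^ k := by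
    intro k x
    rw [← map_pow, ZMod.pow_card_pow]
  have hsum : ∀ (k : ℕ) (r : Fin 2), ∑ j, M r j ^ p ^ k * ZMod.castHom (dvd_refl p) F (a j) =
      rowComb p M r a ^ p ^ k := by
    intro k r
    rw [rowComb, sum_pow_char_pow]
    refine Finset.sum_congr rfl fun j _ => ?_
    rw [mul_pow, ← h, mul_comm]
  split_ifs with hi
  · simp only [gammaRow, if_pos hi, hsum]
  · simp only [gammaRow, if_neg hi, hsum]

/-- If `γ₁₂₃₅(M) ≠ 0`, then a nonzero `𝔽_p`-combination of the columns of `M` is nonzero. -/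
theorem eq_zero_of_rowComb_eq_zero (M : Matrix (Fin 2) (Fin 4) F)
    (h : gam p M ![1, 2, 3, 5] ≠ 0) (a : Fin 4 → ZMod p) (h0 : rowComb p M 0 a = 0)
    (h1 : rowComb p M 1 a = 0) : a = 0 := by
  have hp : p ≠ 0 := (Fact.out : p.Prime).ne_zero
  by_contra ha
  -- A nonzero `a` killed by both rows of M is killed by all their Frobenius powers, hence lies in
  -- the kernel of the matrix of γ₁₂₃₅.
  refine h (Matrix.exists_mulVec_eq_zero_iff.mp
    ⟨fun j => ZMod.castHom (dvd_refl p) F (a j), ?_, ?_⟩)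
  · intro hv
    refine ha (funext fun j => ?_)
    exact (map_eq_zero (ZMod.castHom (dvd_refl p) F)).mp (congrFun hv j)
  · ext i
    change ∑ j, gammaRow p M (![1, 2, 3, 5] i) j * ZMod.castHom (dvd_refl p) F (a j) = 0
    rw [sum_gammaRow_mul, h0, h1, ite_self, zero_pow (pow_ne_zero _ hp)]

end Minors

/-! ### h₁ and h₂ as homogenized additive polynomials. -/

section ExplicitGenerators

variable {F : Type*} [Field F] (p : ℕ)

/-- The homogenization of the additive polynomial `-v^p + α u^p + β v + ε u`, where `u = y / x` and
`v = -δ / x²`. -/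
noncomputable def addPolyA (α β ε : F) : MvPolynomial (Fin 3) F :=
  delta ^ p + C α * X 1 ^ p * X 2 ^ p - C β * delta * X 2 ^ (2 * p - 2) +
    C ε * X 1 * X 2 ^ (2 * p - 1)

/-- The homogenization of the additive polynomial `u^(p³) - a u^(p²) + b u^p - c v + d u`, where
`u = y / x` and `v = -δ / x²`. -/
noncomputable def addPolyB (a b c d : F) : MvPolynomial (Fin 3) F :=
  X 1 ^ p ^ 3 - C a * X 1 ^ p ^ 2 * X 2 ^ (p ^ 3 - p ^ 2) + C b * X 1 ^ p * X 2 ^ (p ^ 3 - p) +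
    C c * delta * X 2 ^ (p ^ 3 - 2) + C d * X 1 * X 2 ^ (p ^ 3 - 1)

variable {p}

theorem rowIndex_data : (Odd 1 ∧ Odd 3 ∧ Odd 5 ∧ Odd 7 ∧ ¬ Odd 2 ∧ ¬ Odd 4) := by decide

theorem denomExp_values : denomExp p 1 = 1 ∧ denomExp p 2 = 2 ∧ denomExp p 3 = p ∧
    denomExp p 4 = 2 * p ∧ denomExp p 5 = p ^ 2 ∧ denomExp p 7 = p ^ 3 := by
  obtain ⟨h1, h3, h5, h7, h2, h4⟩ := rowIndex_data
  simp [denomExp, h3, h5, h7, h2, h4]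

theorem numer_values : (numer p 1 : MvPolynomial (Fin 3) F) = X 1 ∧
    (numer p 2 : MvPolynomial (Fin 3) F) = -delta ∧
    (numer p 3 : MvPolynomial (Fin 3) F) = X 1 ^ p ∧
    (numer p 4 : MvPolynomial (Fin 3) F) = (-delta) ^ p ∧
    (numer p 5 : MvPolynomial (Fin 3) F) = X 1 ^ p ^ 2 ∧
    (numer p 7 : MvPolynomial (Fin 3) F) = X 1 ^ p ^ 3 := by
  obtain ⟨h1, h3, h5, h7, h2, h4⟩ := rowIndex_data
  simp [numer, h3, h5, h7, h2, h4]

theorem clearExp_12345 (h3 : 3 ≤ p) : clearExp p ![1, 2, 3, 4, 5] = p ^ 2 := by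
  have h1 : 2 * p ≤ p ^ 2 := by nlinarith
  obtain ⟨e1, e2, e3, e4, e5, e7⟩ := denomExp_values (p := p)
  apply le_antisymm
  · refine Finset.sup_le fun a _ => ?_
    fin_cases a <;> simp [e1, e2, e3, e4, e5] <;> omega
  · rw [← e5]
    exact Finset.le_sup (f := fun a => denomExp p (![1, 2, 3, 4, 5] a)) (Finset.mem_univ 4)

theorem clearExp_12357 (h3 : 3 ≤ p) : clearExp p ![1, 2, 3, 5, 7] = p ^ 3 := by
  have h1 : 2 * p ≤ p ^ 2 := by nlinarith
  have h2 : p ^ 2 ≤ p ^ 3 := Nat.pow_le_pow_right (by omega) (by norm_num)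
  obtain ⟨e1, e2, e3, e4, e5, e7⟩ := denomExp_values (p := p)
  apply le_antisymm
  · refine Finset.sup_le fun a _ => ?_
    fin_cases a <;> simp [e1, e2, e3, e5, e7] <;> omega
  · rw [← e7]
    exact Finset.le_sup (f := fun a => denomExp p (![1, 2, 3, 5, 7] a)) (Finset.mem_univ 4)

variable (M : Matrix (Fin 2) (Fin 4) F)

theorem complementary_rows_12345 :
    (![1, 2, 3, 4, 5] ∘ (0 : Fin 5).succAbove : Fin 4 → ℕ) = ![2, 3, 4, 5] ∧
    (![1, 2, 3, 4, 5] ∘ (1 : Fin 5).succAbove : Fin 4 → ℕ) = ![1, 3, 4, 5] ∧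
    (![1, 2, 3, 4, 5] ∘ (2 : Fin 5).succAbove : Fin 4 → ℕ) = ![1, 2, 4, 5] ∧
    (![1, 2, 3, 4, 5] ∘ (3 : Fin 5).succAbove : Fin 4 → ℕ) = ![1, 2, 3, 5] ∧
    (![1, 2, 3, 4, 5] ∘ (4 : Fin 5).succAbove : Fin 4 → ℕ) = ![1, 2, 3, 4] := by
  decide

theorem complementary_rows_12357 :
    (![1, 2, 3, 5, 7] ∘ (0 : Fin 5).succAbove : Fin 4 → ℕ) = ![2, 3, 5, 7] ∧
    (![1, 2, 3, 5, 7] ∘ (1 : Fin 5).succAbove : Fin 4 → ℕ) = ![1, 3, 5, 7] ∧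
    (![1, 2, 3, 5, 7] ∘ (2 : Fin 5).succAbove : Fin 4 → ℕ) = ![1, 2, 5, 7] ∧
    (![1, 2, 3, 5, 7] ∘ (3 : Fin 5).succAbove : Fin 4 → ℕ) = ![1, 2, 3, 7] ∧
    (![1, 2, 3, 5, 7] ∘ (4 : Fin 5).succAbove : Fin 4 → ℕ) = ![1, 2, 3, 5] := by
  decide

/-- The denominator x^(p²) belongs to row 5, whose cofactor γ₁₂₃₄ vanishes. The largest denominator
left is x^(2p) in row 4, so x^(p²-2p) splits off. Oddness of p gives (-δ)^p = -δ^p, and with the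
sign of the cofactor δ^p gets coefficient 1. -/
theorem fBar_12345 (h3 : 3 ≤ p) (hodd : Odd p) (h1234 : gam p M ![1, 2, 3, 4] = 0)
    (h1235 : gam p M ![1, 2, 3, 5] ≠ 0) :
    C (gam p M ![1, 2, 3, 5])⁻¹ * fBar p M ![1, 2, 3, 4, 5] = X 2 ^ (p ^ 2 - 2 * p) *
      addPolyA p (gam p M ![1, 2, 4, 5] / gam p M ![1, 2, 3, 5])
        (-(gam p M ![1, 3, 4, 5] / gam p M ![1, 2, 3, 5]))
        (gam p M ![2, 3, 4, 5] / gam p M ![1, 2, 3, 5]) := by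
  have h1 : 2 * p ≤ p ^ 2 := by nlinarith
  obtain ⟨e1, e2, e3, e4, e5, e7⟩ := denomExp_values (p := p)
  obtain ⟨n1, n2, n3, n4, n5, n7⟩ := numer_values (F := F) (p := p)
  obtain ⟨r0, r1, r2, r3, r4⟩ := complementary_rows_12345
  have x1 : (X 2 ^ (p ^ 2 - 1) : MvPolynomial (Fin 3) F) =
      X 2 ^ (p ^ 2 - 2 * p) * X 2 ^ (2 * p - 1) := by rw [← pow_add]; congr 1; omega
  have x2 : (X 2 ^ (p ^ 2 - 2) : MvPolynomial (Fin 3) F) =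
      X 2 ^ (p ^ 2 - 2 * p) * X 2 ^ (2 * p - 2) := by rw [← pow_add]; congr 1; omega
  have x3 : (X 2 ^ (p ^ 2 - p) : MvPolynomial (Fin 3) F) =
      X 2 ^ (p ^ 2 - 2 * p) * X 2 ^ p := by rw [← pow_add]; congr 1; omega
  have hinv : (C (gam p M ![1, 2, 3, 5])⁻¹ * C (gam p M ![1, 2, 3, 5]) : MvPolynomial (Fin 3) F)
      = 1 := by rw [← C_mul, inv_mul_cancel₀ h1235, C_1]
  rw [fBar_eq_sum, clearExp_12345 h3, Fin.sum_univ_five, r0, r1, r2, r3, r4, h1234, addPolyA]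
  simp only [Matrix.cons_val, e1, e2, e3, e4, e5, n1, n2, n3, n4, n5, x1, x2, x3, hodd.neg_pow,
    div_eq_mul_inv, C_mul, C_neg, C_0, Fin.val_zero, Fin.val_one, Fin.val_two, show ((3 : Fin 5) : ℕ) = 3 from rfl,
    show ((4 : Fin 5) : ℕ) = 4 from rfl]
  linear_combination X 2 ^ (p ^ 2 - 2 * p) * delta ^ p * hinv

theorem fBar_12357 (h3 : 3 ≤ p) (h1235 : gam p M ![1, 2, 3, 5] ≠ 0) :
    C (gam p M ![1, 2, 3, 5])⁻¹ * fBar p M ![1, 2, 3, 5, 7] =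
      addPolyB p (gam p M ![1, 2, 3, 7] / gam p M ![1, 2, 3, 5])
        (gam p M ![1, 2, 5, 7] / gam p M ![1, 2, 3, 5])
        (gam p M ![1, 3, 5, 7] / gam p M ![1, 2, 3, 5])
        (gam p M ![2, 3, 5, 7] / gam p M ![1, 2, 3, 5]) := by
  obtain ⟨e1, e2, e3, e4, e5, e7⟩ := denomExp_values (p := p)
  obtain ⟨n1, n2, n3, n4, n5, n7⟩ := numer_values (F := F) (p := p)
  obtain ⟨r0, r1, r2, r3, r4⟩ := complementary_rows_12357
  have hinv : (C (gam p M ![1, 2, 3, 5])⁻¹ * C (gam p M ![1, 2, 3, 5]) : MvPolynomial (Fin 3) F)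
      = 1 := by rw [← C_mul, inv_mul_cancel₀ h1235, C_1]
  rw [fBar_eq_sum, clearExp_12357 h3, Fin.sum_univ_five, r0, r1, r2, r3, r4, addPolyB]
  simp only [Matrix.cons_val, e1, e2, e3, e5, e7, n1, n2, n3, n5, n7, div_eq_mul_inv, C_mul,
    Fin.val_zero, Fin.val_one, Fin.val_two, show ((3 : Fin 5) : ℕ) = 3 from rfl,
    show ((4 : Fin 5) : ℕ) = 4 from rfl, Nat.sub_self, pow_zero]
  linear_combination X 1 ^ p ^ 3 * hinv

theorem divXPow_X_pow_mul (n : ℕ) (g : MvPolynomial (Fin 3) F) :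
    divXPow n (X 2 ^ n * g) = g := by
  rw [divXPow, X_pow_eq_monomial, divMonomial_monomial_mul]

variable [Fact p.Prime] [CharP F p]

/-- With the pair (r₀(a), r₁(a)) in place of (u, v), the extra column is an 𝔽_p-combination of the
other four, so the determinant vanishes. This is what makes h₁ invariant. -/
theorem addPolyA_relation (h1234 : gam p M ![1, 2, 3, 4] = 0)
    (h1235 : gam p M ![1, 2, 3, 5] ≠ 0) (a : Fin 4 → ZMod p) :
    -rowComb p M 1 a ^ p + gam p M ![1, 2, 4, 5] / gam p M ![1, 2, 3, 5] * rowComb p M 0 a ^ p +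
      -(gam p M ![1, 3, 4, 5] / gam p M ![1, 2, 3, 5]) * rowComb p M 1 a +
      gam p M ![2, 3, 4, 5] / gam p M ![1, 2, 3, 5] * rowComb p M 0 a = 0 := by
  obtain ⟨r0, r1, r2, r3, r4⟩ := complementary_rows_12345
  obtain ⟨h1, h3, h5, h7, h2, h4⟩ := rowIndex_data
  have h := sum_gam_mul_eq_zero p M ![1, 2, 3, 4, 5] fun j => ZMod.castHom (dvd_refl p) F (a j)
  simp only [sum_gammaRow_mul] at h
  rw [Fin.sum_univ_five, r0, r1, r2, r3, r4, h1234] at h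
  simp [h3, h2, h4] at h
  field_simp
  linear_combination h

theorem addPolyB_relation (h1235 : gam p M ![1, 2, 3, 5] ≠ 0) (a : Fin 4 → ZMod p) :
    rowComb p M 0 a ^ p ^ 3 - gam p M ![1, 2, 3, 7] / gam p M ![1, 2, 3, 5] *
        rowComb p M 0 a ^ p ^ 2 +
      gam p M ![1, 2, 5, 7] / gam p M ![1, 2, 3, 5] * rowComb p M 0 a ^ p -
      gam p M ![1, 3, 5, 7] / gam p M ![1, 2, 3, 5] * rowComb p M 1 a +
      gam p M ![2, 3, 5, 7] / gam p M ![1, 2, 3, 5] * rowComb p M 0 a = 0 := by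
  obtain ⟨r0, r1, r2, r3, r4⟩ := complementary_rows_12357
  obtain ⟨h1, h3, h5, h7, h2, h4⟩ := rowIndex_data
  have h := sum_gam_mul_eq_zero p M ![1, 2, 3, 5, 7] fun j => ZMod.castHom (dvd_refl p) F (a j)
  simp only [sum_gammaRow_mul] at h
  rw [Fin.sum_univ_five, r0, r1, r2, r3, r4] at h
  simp [h3, h2, h5, h7] at h
  field_simp
  linear_combination h

end ExplicitGenerators

/-! ### Homogeneity, and the cancellation that produces h₃. -/

section ThirdGenerator

variable {F : Type*} [Field F]

theorem exists_add_mul_pow_eq {A : Type*} [CommRing A] (s t g : A) (n : ℕ) :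
    ∃ g', (s + t * g) ^ n = s ^ n + t * g' := by
  obtain ⟨k, hk⟩ := sub_dvd_pow_sub_pow (s + t * g) s n
  exact ⟨g * k, by linear_combination hk⟩

theorem isHomogeneous_delta : (delta : MvPolynomial (Fin 3) F).IsHomogeneous 2 := by
  refine IsHomogeneous.sub ?_ ?_
  · exact isHomogeneous_X_pow _ _
  · exact (isHomogeneous_X _ _).mul (isHomogeneous_X _ _)

theorem isHomogeneous_addPolyA {p : ℕ} (h3 : 3 ≤ p) (α β ε : F) :
    (addPolyA p α β ε).IsHomogeneous (2 * p) := by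
  refine ((IsHomogeneous.add ?_ ?_).sub ?_).add ?_
  · exact isHomogeneous_delta.pow _
  · convert ((isHomogeneous_C _ _).mul (isHomogeneous_X_pow _ _)).mul (isHomogeneous_X_pow _ _)
      using 1
    omega
  · have h := ((isHomogeneous_C (Fin 3) β).mul isHomogeneous_delta).mul
      (isHomogeneous_X_pow (R := F) 2 (2 * p - 2))
    rwa [show 0 + 2 + (2 * p - 2) = 2 * p by omega] at h
  · convert ((isHomogeneous_C _ _).mul (isHomogeneous_X _ _)).mul (isHomogeneous_X_pow _ _) using 1
    omega

theorem pow_bounds {p : ℕ} (h3 : 3 ≤ p) : 3 * p ≤ p ^ 2 ∧ 3 * p ^ 2 ≤ p ^ 3 := by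
  constructor
  · nlinarith
  · nlinarith [Nat.zero_le (p ^ 2)]

theorem isHomogeneous_addPolyB {p : ℕ} (h3 : 3 ≤ p) (a b c d : F) :
    (addPolyB p a b c d).IsHomogeneous (p ^ 3) := by
  obtain ⟨b1, b2⟩ := pow_bounds h3
  refine (((IsHomogeneous.sub ?_ ?_).add ?_).add ?_).add ?_
  · exact isHomogeneous_X_pow _ _
  · convert ((isHomogeneous_C _ _).mul (isHomogeneous_X_pow _ _)).mul (isHomogeneous_X_pow _ _)
      using 1
    omega
  · convert ((isHomogeneous_C _ _).mul (isHomogeneous_X_pow _ _)).mul (isHomogeneous_X_pow _ _)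
      using 1
    omega
  · have h := ((isHomogeneous_C (Fin 3) c).mul isHomogeneous_delta).mul
      (isHomogeneous_X_pow (R := F) 2 (p ^ 3 - 2))
    rwa [show 0 + 2 + (p ^ 3 - 2) = p ^ 3 by omega] at h
  · convert ((isHomogeneous_C _ _).mul (isHomogeneous_X _ _)).mul (isHomogeneous_X_pow _ _) using 1
    omega

variable {p : ℕ}

/-- In the square of h₂ the tail enters twice: in the cross term with y^(p³), where its summands are
needed one by one, and squared, where only its power of x matters. The two equations serve these two
uses. -/
theorem exists_addPolyB_eq (h3 : 3 ≤ p) (a b c d : F) :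
    ∃ g, addPolyB p a b c d = X 1 ^ p ^ 3 + X 2 ^ (p ^ 3 - p ^ 2) * g ∧
      X 2 ^ (p ^ 3 - p ^ 2) * g = - C a * X 1 ^ p ^ 2 * X 2 ^ (p ^ 3 - p ^ 2) +
        C b * X 1 ^ p * X 2 ^ (p ^ 3 - p) +
        C c * delta * X 2 ^ (p ^ 3 - 2) + C d * X 1 * X 2 ^ (p ^ 3 - 2) * X 2 := by
  obtain ⟨b1, b2⟩ := pow_bounds h3
  have x1 : (X 2 ^ (p ^ 3 - 1) : MvPolynomial (Fin 3) F) =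
      X 2 ^ (p ^ 3 - 2) * X 2 := by rw [← pow_succ]; congr 1; omega
  have x2 : (X 2 ^ (p ^ 3 - 2) : MvPolynomial (Fin 3) F) =
      X 2 ^ (p ^ 3 - p ^ 2) * X 2 ^ (p ^ 2 - 2) := by rw [← pow_add]; congr 1; omega
  have x3 : (X 2 ^ (p ^ 3 - p) : MvPolynomial (Fin 3) F) =
      X 2 ^ (p ^ 3 - p ^ 2) * X 2 ^ (p ^ 2 - p) := by rw [← pow_add]; congr 1; omega
  refine ⟨- C a * X 1 ^ p ^ 2 + C b * X 1 ^ p * X 2 ^ (p ^ 2 - p) + C c * delta * X 2 ^ (p ^ 2 - 2) +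
    C d * X 1 * X 2 ^ (p ^ 2 - 2) * X 2, ?_, ?_⟩
  · rw [addPolyB, x1, x2, x3]
    ring
  · rw [x2, x3]
    ring

variable [Fact p.Prime] [CharP F p]

/-- By Frobenius δ^p = y^(2p) - x^p z^p, and all other terms carry at least x^p. -/
theorem exists_addPolyA_eq (h3 : 3 ≤ p) (α β ε : F) :
    ∃ g, addPolyA p α β ε = X 1 ^ (2 * p) + X 2 ^ p * g := by
  have x1 : (X 2 ^ (2 * p - 1) : MvPolynomial (Fin 3) F) =
      X 2 ^ p * X 2 ^ (p - 1) := by rw [← pow_add]; congr 1; omega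
  have x2 : (X 2 ^ (2 * p - 2) : MvPolynomial (Fin 3) F) =
      X 2 ^ p * X 2 ^ (p - 2) := by rw [← pow_add]; congr 1; omega
  refine ⟨-X 0 ^ p + C α * X 1 ^ p - C β * delta * X 2 ^ (p - 2) + C ε * X 1 * X 2 ^ (p - 1), ?_⟩
  rw [addPolyA, x1, x2, delta, sub_pow_char]
  ring

/-- The polynomial `h̃₃` for given `h₁` and `h₂`. -/
noncomputable def tatRemainder (p : ℕ) (a b : F) (h₁ h₂ : MvPolynomial (Fin 3) F) :
    MvPolynomial (Fin 3) F :=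
  h₂ ^ 2 - h₁ ^ p ^ 2 + C (2 * a) * h₁ ^ (p * (p + 1) / 2) * X 2 ^ (p ^ 3 - p ^ 2) -
    C (2 * b) * h₁ ^ ((p ^ 2 + 1) / 2) * X 2 ^ (p ^ 3 - p)

/-- In h₂² - h₁^(p²) the terms y^(2p³) cancel, and the two correction terms remove the cross terms
-2a y^(p³+p²) x^(p³-p²) and 2b y^(p³+p) x^(p³-p). The lowest power of x left is in 2c y^(p³) δ
x^(p³-2); everything else is divisible by x^(p³-1), and δ is y² modulo x. -/
theorem exists_tatRemainder_eq (h3 : 3 ≤ p) (hodd : Odd p) (α β ε a b d : F) {c : F} (hc : 2 * c ≠ 0) :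
    ∃ g, tatRemainder p a b (addPolyA p α β ε) (addPolyB p a b c d) =
        X 2 ^ (p ^ 3 - 2) * (C (2 * c) * g) ∧ X 2 ∣ g - X 1 ^ (p ^ 3 + 2) := by
  obtain ⟨b1, b2⟩ := pow_bounds h3
  obtain ⟨g, hg⟩ := exists_addPolyA_eq h3 α β ε
  obtain ⟨s, hs, hs'⟩ := exists_addPolyB_eq h3 a b c d
  obtain ⟨k, hk⟩ : ∃ k, p + 1 = 2 * k := by
    obtain ⟨m, hm⟩ := hodd
    exact ⟨m + 1, by omega⟩
  obtain ⟨l, hl⟩ : ∃ l, p ^ 2 + 1 = 2 * l := by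
    obtain ⟨m, hm⟩ := hodd.pow (n := 2)
    exact ⟨m + 1, by omega⟩
  have t1 : addPolyA p α β ε ^ p ^ 2 = X 1 ^ (2 * p ^ 3) + X 2 ^ (p ^ 3) * g ^ p ^ 2 := by
    rw [hg, add_pow_char_pow, mul_pow, ← pow_mul, ← pow_mul]
    ring
  -- The exponent is chosen so that 2p · p(p+1)/2 = p³ + p². Taking the p-th power first gives an
  -- error divisible by x^(p²), which the factor x^(p³-p²) raises to x^(p³).
  obtain ⟨g₂, t2⟩ : ∃ g', addPolyA p α β ε ^ (p * (p + 1) / 2) =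
      X 1 ^ (p ^ 3) * X 1 ^ p ^ 2 + X 2 ^ p ^ 2 * g' := by
    obtain ⟨g', hg'⟩ := exists_add_mul_pow_eq ((X 1 : MvPolynomial (Fin 3) F) ^ (2 * p * p))
      (X 2 ^ (p * p)) (g ^ p) k
    refine ⟨g', ?_⟩
    have : p * (p + 1) / 2 = p * k := by rw [hk, mul_left_comm, Nat.mul_div_cancel_left _ two_pos]
    rw [this, pow_mul, hg, add_pow_char, mul_pow, ← pow_mul, ← pow_mul, hg', ← pow_mul, ← pow_add,
      show 2 * p * p * k = p ^ 3 + p ^ 2 by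
        rw [show 2 * p * p * k = p * p * (2 * k) by ring, ← hk]; ring, ← sq]
  -- Here 2p · (p²+1)/2 = p³ + p, and an error divisible by x^p is enough, since it is multiplied by
  -- x^(p³-p).
  obtain ⟨g₃, t3⟩ : ∃ g', addPolyA p α β ε ^ ((p ^ 2 + 1) / 2) =
      X 1 ^ (p ^ 3) * X 1 ^ p + X 2 ^ p * g' := by
    obtain ⟨g', hg'⟩ := exists_add_mul_pow_eq ((X 1 : MvPolynomial (Fin 3) F) ^ (2 * p))
      (X 2 ^ p) g l
    refine ⟨g', ?_⟩
    have : (p ^ 2 + 1) / 2 = l := by omega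
    rw [this, hg, hg', ← pow_mul, ← pow_add,
      show 2 * p * l = p ^ 3 + p by rw [show 2 * p * l = p * (2 * l) by ring, ← hl]; ring]
  have x1 : (X 2 ^ (p ^ 3) : MvPolynomial (Fin 3) F) = X 2 ^ (p ^ 3 - 2) * X 2 ^ 2 := by
    rw [← pow_add]; congr 1; omega
  have x2 : (X 2 ^ p ^ 2 * X 2 ^ (p ^ 3 - p ^ 2) : MvPolynomial (Fin 3) F) =
      X 2 ^ (p ^ 3 - 2) * X 2 ^ 2 := by rw [← pow_add, ← pow_add]; congr 1; omega
  have x3 : (X 2 ^ p * X 2 ^ (p ^ 3 - p) : MvPolynomial (Fin 3) F) =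
      X 2 ^ (p ^ 3 - 2) * X 2 ^ 2 := by rw [← pow_add, ← pow_add]; congr 1; omega
  have x4 : ((X 2 ^ (p ^ 3 - p ^ 2)) ^ 2 : MvPolynomial (Fin 3) F) =
      X 2 ^ (p ^ 3 - 2) * X 2 ^ 2 * X 2 ^ (p ^ 3 - 2 * p ^ 2) := by
    rw [← pow_mul, ← pow_add, ← pow_add]; congr 1; omega
  have hinv : (C (2 * c) * C (2 * c)⁻¹ : MvPolynomial (Fin 3) F) = 1 := by
    rw [← C_mul, mul_inv_cancel₀ hc, C_1]
  have hC : ∀ r : F, (C (2 * r) : MvPolynomial (Fin 3) F) = 2 * C r := fun r => by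
    rw [C_mul]; rfl
  -- G collects everything divisible by x^(p³), with that factor removed; it contributes x² · G
  -- after division by x^(p³-2).
  let G : MvPolynomial (Fin 3) F := X 2 ^ (p ^ 3 - 2 * p ^ 2) * s ^ 2 - g ^ p ^ 2 +
    C (2 * a) * g₂ - C (2 * b) * g₃
  refine ⟨X 1 ^ p ^ 3 * delta + C (2 * c)⁻¹ * X 2 * (2 * C d * X 1 ^ p ^ 3 * X 1 + X 2 * G), ?_, ?_⟩
  · have hsq : addPolyB p a b c d ^ 2 = X 1 ^ (2 * p ^ 3) +
        2 * X 1 ^ p ^ 3 * (X 2 ^ (p ^ 3 - p ^ 2) * s) + (X 2 ^ (p ^ 3 - p ^ 2)) ^ 2 * s ^ 2 := by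
      rw [hs]; ring
    rw [tatRemainder, hsq, hs', t1, t2, t3, x4, x1]
    simp only [G, hC] at hinv ⊢
    linear_combination (2 * C a * g₂) * x2 - 2 * C b * g₃ * x3 - X 2 ^ (p ^ 3 - 2) * X 2 *
      (2 * C d * X 1 ^ p ^ 3 * X 1 + X 2 * (X 2 ^ (p ^ 3 - 2 * p ^ 2) * s ^ 2 - g ^ p ^ 2 +
    2 * C a * g₂ - 2 * C b * g₃)) * hinv
  · refine ⟨-X 1 ^ p ^ 3 * X 0 + C (2 * c)⁻¹ * (2 * C d * X 1 ^ p ^ 3 * X 1 + X 2 * G), ?_⟩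
    rw [delta]
    ring

end ThirdGenerator

/-! ### The action of E and its first invariants. -/

section Action

variable {F : Type*} [Field F] {p : ℕ} [CharP F p]
  (M : Matrix (Fin 2) (Fin 4) F) (e : Multiplicative (Fin 4 → ZMod p))

theorem act_X_two : act p M e (X 2) = X 2 := by
  simp [act, repV, sigmaMatrix, Fin.sum_univ_three]

theorem act_X_one : act p M e (X 1) = X 1 + C (rowComb p M 0 e.toAdd) * X 2 := by
  simp [act, repV, sigmaMatrix, Fin.sum_univ_three]

theorem act_X_zero : act p M e (X 0) = X 0 + 2 * C (rowComb p M 0 e.toAdd) * X 1 +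
    (C (rowComb p M 0 e.toAdd) ^ 2 + C (rowComb p M 1 e.toAdd)) * X 2 := by
  have h2 : (C 2 : MvPolynomial (Fin 3) F) = 2 := rfl
  simp [act, h2, repV, sigmaMatrix, Fin.sum_univ_three]

theorem act_C (r : F) : act p M e (C r) = C r := (act p M e).commutes r

/-- The quadratic entries of σ are arranged so that -δ/x² is merely translated by r₁(e). -/
theorem act_delta : act p M e delta = delta - C (rowComb p M 1 e.toAdd) * X 2 ^ 2 := by
  simp only [delta, map_sub, map_mul, map_pow, act_X_two, act_X_one, act_X_zero]
  ring

theorem isHomogeneous_act {f : MvPolynomial (Fin 3) F} {n : ℕ} (hf : f.IsHomogeneous n) :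
    (act p M e f).IsHomogeneous n := by
  have := hf.aeval (fun i => ∑ k, C (repV p M e i k) * X k)
    (n := 1) fun i => IsHomogeneous.sum _ _ _ fun k _ => isHomogeneous_C_mul_X _ _
  simpa [act] using this

theorem act_act (e' : Multiplicative (Fin 4 → ZMod p)) (f : MvPolynomial (Fin 3) F) :
    act p M e (act p M e' f) = act p M (e' * e) f := by
  have hadd : ∀ i, rowComb p M i (e' * e).toAdd =
      rowComb p M i e'.toAdd + rowComb p M i e.toAdd := by
    intro i
    simp [rowComb, add_mul, Finset.sum_add_distrib]
  have h : (act p M e).comp (act p M e') = act p M (e' * e) := by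
    ext1 i
    rw [AlgHom.comp_apply]
    fin_cases i
    · change act p M e (act p M e' (X 0)) = act p M (e' * e) (X 0)
      simp only [act_X_zero, act_X_one, act_X_two, act_C, map_add, map_mul, map_pow, map_ofNat, hadd]
      ring
    · change act p M e (act p M e' (X 1)) = act p M (e' * e) (X 1)
      simp only [act_X_one, act_X_two, act_C, map_add, map_mul, hadd]
      ring
    · change act p M e (act p M e' (X 2)) = act p M (e' * e) (X 2)
      simp only [act_X_two]
  exact DFunLike.congr_fun h f

theorem homogeneousComponent_mem_invariants {f : MvPolynomial (Fin 3) F}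
    (hf : f ∈ invariants p M) (n : ℕ) : homogeneousComponent n f ∈ invariants p M := by
  classical
  rw [mem_invariants] at hf ⊢
  intro e
  have h : homogeneousComponent n (act p M e f) = act p M e (homogeneousComponent n f) := by
    conv_lhs => rw [← sum_homogeneousComponent f, map_sum, map_sum]
    rw [Finset.sum_eq_single n]
    · exact homogeneousComponent_eq_self (isHomogeneous_act M e (homogeneousComponent_isHomogeneous n f))
    · intro k _ hk
      rw [homogeneousComponent_of_mem (isHomogeneous_act M e (homogeneousComponent_isHomogeneous k f)),
        if_neg hk.symm]
    · intro hn
      rw [homogeneousComponent_eq_zero n f (by simpa using hn), map_zero, map_zero]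
  rw [← h, hf]

theorem X_two_mem_invariants : (X 2 : MvPolynomial (Fin 3) F) ∈ invariants p M := by
  rw [mem_invariants]
  exact fun e => act_X_two M e

theorem mem_invariants_of_X_pow_mul {n : ℕ} {f : MvPolynomial (Fin 3) F}
    (h : X 2 ^ n * f ∈ invariants p M) : f ∈ invariants p M := by
  rw [mem_invariants] at h ⊢
  intro e
  have := h e
  rw [map_mul, map_pow, act_X_two] at this
  exact mul_left_cancel₀ (pow_ne_zero _ (X_ne_zero 2)) this

variable [Fact p.Prime]

/-- An additive polynomial changes under a translation by its value at the translation vector, which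
is 0 by `h`. The remaining work is collecting the homogenizing powers of x. -/
theorem addPolyA_mem_invariants (h3 : 3 ≤ p) (α β ε : F)
    (h : ∀ a, -rowComb p M 1 a ^ p + α * rowComb p M 0 a ^ p + β * rowComb p M 1 a +
      ε * rowComb p M 0 a = 0) : addPolyA p α β ε ∈ invariants p M := by
  rw [mem_invariants]
  intro e
  have hC := congrArg (C : F → MvPolynomial (Fin 3) F) (h e.toAdd)
  simp only [C_add, C_mul, C_pow, C_neg, C_0] at hC
  have x1 : (X 2 ^ (2 * p - 1) * X 2 : MvPolynomial (Fin 3) F) = X 2 ^ p * X 2 ^ p := by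
    rw [← pow_succ, ← pow_add]; congr 1; omega
  have x2 : (X 2 ^ (2 * p - 2) * X 2 ^ 2 : MvPolynomial (Fin 3) F) = X 2 ^ p * X 2 ^ p := by
    rw [← pow_add, ← pow_add]; congr 1; omega
  have x3 : ((X 2 ^ 2) ^ p : MvPolynomial (Fin 3) F) = X 2 ^ p * X 2 ^ p := by
    rw [← pow_mul, ← pow_add]; congr 1; omega
  simp only [addPolyA, map_add, map_sub, map_mul, map_pow, act_X_two, act_X_one, act_delta, act_C,
    add_pow_char, sub_pow_char, mul_pow, x3]
  linear_combination X 2 ^ p * X 2 ^ p * hC + C ε * C (rowComb p M 0 e.toAdd) * x1 +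
    C β * C (rowComb p M 1 e.toAdd) * x2

theorem addPolyB_mem_invariants (h3 : 3 ≤ p) (a b c d : F)
    (h : ∀ v, rowComb p M 0 v ^ p ^ 3 - a * rowComb p M 0 v ^ p ^ 2 + b * rowComb p M 0 v ^ p -
      c * rowComb p M 1 v + d * rowComb p M 0 v = 0) : addPolyB p a b c d ∈ invariants p M := by
  obtain ⟨b1, b2⟩ := pow_bounds h3
  rw [mem_invariants]
  intro e
  have hC := congrArg (C : F → MvPolynomial (Fin 3) F) (h e.toAdd)
  simp only [C_add, C_mul, C_pow, C_sub, C_0] at hC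
  have x1 : (X 2 ^ (p ^ 3 - 1) * X 2 : MvPolynomial (Fin 3) F) = X 2 ^ p ^ 3 := by
    rw [← pow_succ]; congr 1; omega
  have x2 : (X 2 ^ (p ^ 3 - 2) * X 2 ^ 2 : MvPolynomial (Fin 3) F) = X 2 ^ p ^ 3 := by
    rw [← pow_add]; congr 1; omega
  have x3 : (X 2 ^ (p ^ 3 - p) * X 2 ^ p : MvPolynomial (Fin 3) F) = X 2 ^ p ^ 3 := by
    rw [← pow_add]; congr 1; omega
  have x4 : (X 2 ^ (p ^ 3 - p ^ 2) * X 2 ^ p ^ 2 : MvPolynomial (Fin 3) F) = X 2 ^ p ^ 3 := by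
    rw [← pow_add]; congr 1; omega
  simp only [addPolyB, map_add, map_sub, map_mul, map_pow, act_X_two, act_X_one, act_delta, act_C,
    add_pow_char, add_pow_char_pow, mul_pow]
  linear_combination X 2 ^ p ^ 3 * hC + C d * C (rowComb p M 0 e.toAdd) * x1 -
    C c * C (rowComb p M 1 e.toAdd) * x2 + C b * C (rowComb p M 0 e.toAdd) ^ p * x3 -
    C a * C (rowComb p M 0 e.toAdd) ^ p ^ 2 * x4

theorem normM_mem_invariants (f : MvPolynomial (Fin 3) F) : normM p M f ∈ invariants p M := by
  classical
  rw [mem_invariants]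
  intro e
  rw [normM, map_prod]
  have hinj : Function.Injective (act p M e) := by
    refine Function.LeftInverse.injective (g := act p M e⁻¹) fun g => ?_
    rw [act_act, mul_inv_cancel]
    have : act p M 1 = AlgHom.id F _ := by
      ext1 i
      rw [act, map_one, aeval_X]
      simp [Matrix.one_apply]
    rw [this, AlgHom.id_apply]
  -- The automorphism permutes the orbit, so the image of the product is the product over the same
  -- set.
  rw [← Finset.prod_image (f := fun q => q) (g := act p M e) fun _ _ _ _ h => hinj h]
  congr 1
  ext q
  simp only [Finset.mem_image, Finset.mem_univ, true_and, exists_exists_eq_and, act_act]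
  constructor
  · rintro ⟨e', rfl⟩
    exact ⟨e' * e, rfl⟩
  · rintro ⟨e', rfl⟩
    exact ⟨e' * e⁻¹, by rw [inv_mul_cancel_right]⟩

/-- The orbit of z is free: the coefficient 2r₀ of y and then the coefficient r₀² + r₁ of x
determine the group element. -/
theorem normM_X_zero (hinj : ∀ a : Fin 4 → ZMod p, rowComb p M 0 a = 0 → rowComb p M 1 a = 0 → a = 0)
    (h2 : (2 : F) ≠ 0) :
    normM p M (X 0) = ∏ e : Multiplicative (Fin 4 → ZMod p), act p M e (X 0) := by
  classical
  rw [normM, Finset.prod_image]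
  intro e _ e' _ h
  have hsub : ∀ i, rowComb p M i (e.toAdd - e'.toAdd) =
      rowComb p M i e.toAdd - rowComb p M i e'.toAdd := by
    intro i
    simp [rowComb, sub_mul]
  simp only [act_X_zero] at h
  have h0 := congrArg (coeff (Finsupp.single 1 1)) h
  have h1 := congrArg (coeff (Finsupp.single 2 1)) h
  have e2 : (2 : MvPolynomial (Fin 3) F) = C 2 := rfl
  simp only [e2, ← C_mul, ← C_pow, ← C_add, coeff_add, coeff_C_mul, coeff_X, Finsupp.single_left_inj (one_ne_zero)] at h0 h1
  simp at h0 h1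
  have h0' := h0.resolve_right h2
  refine Multiplicative.toAdd.injective (sub_eq_zero.mp (hinj _ ?_ ?_))
  · rw [hsub, h0', sub_self]
  · rw [h0'] at h1
    rw [hsub, add_left_cancel h1, sub_self]

end Action

/-! ### Translation invariants in one variable. -/

section OneVariable

/-- If `q` is monic with `natDegree q` roots such that `q` is invariant under the translations by
these roots, then `q` generates the ring of invariants of these translations. -/
theorem mem_adjoin_of_translation_invariant {D : Type*} [CommRing D] [IsDomain D]
    {q : Polynomial D} (hq : q.Monic) (hpos : 0 < q.natDegree) {s : Finset D}
    (hs : s.card = q.natDegree) (hroot : ∀ r ∈ s, q.eval r = 0)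
    (hinv : ∀ r ∈ s, q.comp (Polynomial.X + Polynomial.C r) = q) (f : Polynomial D)
    (hf : ∀ r ∈ s, f.comp (Polynomial.X + Polynomial.C r) = f) :
    f ∈ Algebra.adjoin D {q} := by
  classical
  have hq0 := hq.ne_zero
  have hsq : s.val = q.roots := by
    refine Multiset.eq_of_le_of_card_le ?_ ?_
    · rw [Multiset.le_iff_subset s.nodup]
      intro r hr
      exact (Polynomial.mem_roots hq0).mpr (hroot r hr)
    · exact (Polynomial.card_roots' q).trans hs.ge
  have hprod : (q.roots.map fun r => Polynomial.X - Polynomial.C r).prod = q := by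
    refine Polynomial.prod_multiset_X_sub_C_of_monic_of_roots_card_eq hq ?_
    rw [← hsq]
    exact hs
  induction hn : f.natDegree using Nat.strong_induction_on generalizing f with
  | _ n ih =>
    -- Invariance gives f(r) = f(0) at every root r of q, so f - f(0) is a multiple of q. The
    -- quotient is again invariant and has smaller degree.
    obtain ⟨k, hk⟩ : q ∣ f - Polynomial.C (f.eval 0) := by
      by_cases hg : f - Polynomial.C (f.eval 0) = 0
      · rw [hg]
        exact dvd_zero q
      · rw [← hprod, Multiset.prod_X_sub_C_dvd_iff_le_roots hg, ← hsq,
          Multiset.le_iff_subset s.nodup]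
        intro r hr
        rw [Polynomial.mem_roots hg, Polynomial.IsRoot, Polynomial.eval_sub, Polynomial.eval_C,
          sub_eq_zero]
        nth_rewrite 2 [← hf r hr]
        simp
    have hfk : f = Polynomial.C (f.eval 0) + q * k := by rw [← hk]; ring
    by_cases hk0 : k = 0
    · rw [hfk, hk0, mul_zero, add_zero]
      exact Subalgebra.algebraMap_mem _ _
    · have hkinv : ∀ r ∈ s, k.comp (Polynomial.X + Polynomial.C r) = k := by
        intro r hr
        have h1 := hf r hr
        rw [hfk, Polynomial.add_comp, Polynomial.mul_comp, hinv r hr, Polynomial.C_comp] at h1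
        exact mul_left_cancel₀ hq0 (add_left_cancel h1)
      have hdeg : k.natDegree < n := by
        have h1 : (q * k).natDegree ≤ f.natDegree := by
          rw [← hk]
          exact (Polynomial.natDegree_sub_le _ _).trans (by simp)
        rw [Polynomial.natDegree_mul hq0 hk0] at h1
        omega
      rw [hfk]
      exact add_mem (Subalgebra.algebraMap_mem _ _)
        (mul_mem (Algebra.subset_adjoin rfl) (ih _ hdeg k hkinv rfl))

end OneVariable

/-! ### Setting x = 1, and the additive polynomial Q in u. -/

section Dehomogenization

variable {F : Type*} [Field F]

/-- Setting `x = 1` in the coordinates `u = y / x`, `v = -δ / x²`; the variables `u` and `v` of the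
target are `X 1` and `X 0`. -/
noncomputable def dehomog : MvPolynomial (Fin 3) F →ₐ[F] MvPolynomial (Fin 3) F :=
  aeval ![X 0 + X 1 ^ 2, X 1, 1]

theorem dehomog_X_zero : dehomog (X 0 : MvPolynomial (Fin 3) F) = X 0 + X 1 ^ 2 := by
  simp [dehomog]

theorem dehomog_X_one : dehomog (X 1 : MvPolynomial (Fin 3) F) = X 1 := by
  simp [dehomog]

theorem dehomog_X_two : dehomog (X 2 : MvPolynomial (Fin 3) F) = 1 := by
  simp [dehomog]

theorem dehomog_C (r : F) : dehomog (C r) = C r := (dehomog (F := F)).commutes r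

theorem dehomog_delta : dehomog (delta : MvPolynomial (Fin 3) F) = -X 0 := by
  rw [delta, map_sub, map_mul, map_pow, dehomog_X_zero, dehomog_X_one, dehomog_X_two]
  ring

theorem dehomog_addPolyA {p : ℕ} (hodd : Odd p) (α β ε : F) :
    dehomog (addPolyA p α β ε) = -X 0 ^ p + C α * X 1 ^ p + C β * X 0 + C ε * X 1 := by
  simp only [addPolyA, map_add, map_sub, map_mul, map_pow, dehomog_delta, dehomog_X_one,
    dehomog_X_two, dehomog_C, hodd.neg_pow, one_pow]
  ring

theorem dehomog_addPolyB {p : ℕ} (a b c d : F) :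
    dehomog (addPolyB p a b c d) =
      X 1 ^ p ^ 3 - C a * X 1 ^ p ^ 2 + C b * X 1 ^ p - C c * X 0 + C d * X 1 := by
  simp only [addPolyB, map_add, map_sub, map_mul, map_pow, dehomog_delta, dehomog_X_one,
    dehomog_X_two, dehomog_C, one_pow]
  ring

/-- The additive polynomial `t^(p³) - a t^(p²) + b t^p + d t`. -/
def addPolyU {A : Type*} [CommRing A] (p : ℕ) (a b d t : A) : A :=
  t ^ p ^ 3 - a * t ^ p ^ 2 + b * t ^ p + d * t

theorem addPolyU_add {A : Type*} [CommRing A] (p : ℕ) [Fact p.Prime] [CharP A p] (a b d s t : A) :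
    addPolyU p a b d (s + t) = addPolyU p a b d s + addPolyU p a b d t := by
  simp only [addPolyU, add_pow_char_pow, add_pow_char]
  ring

theorem map_addPolyU {A B : Type*} [CommRing A] [CommRing B] (φ : A →+* B) (p : ℕ) (a b d t : A) :
    φ (addPolyU p a b d t) = addPolyU p (φ a) (φ b) (φ d) (φ t) := by
  simp [addPolyU]

/-- The polynomial obtained by eliminating `v` from `-v^p + α u^p + β v + ε u` by means of
`h = u^(p³) - a u^(p²) + b u^p - c v + d u` (up to terms in `h` only), made monic. -/
def addPolyQ {A : Type*} [CommRing A] (p : ℕ) (α β ε a b c d t : A) : A :=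
  addPolyU p a b d t ^ p - c ^ p * (α * t ^ p + ε * t) - c ^ (p - 1) * β * addPolyU p a b d t

theorem addPolyQ_add {A : Type*} [CommRing A] (p : ℕ) [Fact p.Prime] [CharP A p]
    (α β ε a b c d s t : A) : addPolyQ p α β ε a b c d (s + t) =
      addPolyQ p α β ε a b c d s + addPolyQ p α β ε a b c d t := by
  simp only [addPolyQ, addPolyU_add, add_pow_char]
  ring

theorem map_addPolyQ {A B : Type*} [CommRing A] [CommRing B] (φ : A →+* B) (p : ℕ)
    (α β ε a b c d t : A) : φ (addPolyQ p α β ε a b c d t) =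
      addPolyQ p (φ α) (φ β) (φ ε) (φ a) (φ b) (φ c) (φ d) (φ t) := by
  simp [addPolyQ, map_addPolyU]

/-- This is Q = B^p - c^(p-1)βB - c^pA, in which all terms containing v cancel. It serves twice: Q
vanishes wherever A and B do, and Q lies in F[A, B]. -/
theorem addPolyQ_eq {A : Type*} [CommRing A] (p : ℕ) [Fact p.Prime] [CharP A p]
    (α β ε a b c d u v : A) : addPolyQ p α β ε a b c d u =
      (addPolyU p a b d u - c * v) ^ p - c ^ (p - 1) * β * (addPolyU p a b d u - c * v) -
        c ^ p * (-v ^ p + α * u ^ p + β * v + ε * u) := by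
  have hp : c ^ p = c ^ (p - 1) * c := by
    rw [← pow_succ, Nat.sub_add_cancel (Fact.out : p.Prime).one_le]
  rw [addPolyQ, sub_pow_char, mul_pow, hp]
  ring

/-- By Frobenius U^p starts with t^(p⁴), and every other term has degree at most p³. -/
theorem monic_addPolyQ {A : Type*} [CommRing A] [Nontrivial A] (p : ℕ) [Fact p.Prime] [CharP A p]
    (α β ε a b c d : A) :
    (addPolyQ p (Polynomial.C α) (Polynomial.C β) (Polynomial.C ε) (Polynomial.C a)
      (Polynomial.C b) (Polynomial.C c) (Polynomial.C d) Polynomial.X).Monic ∧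
    (addPolyQ p (Polynomial.C α) (Polynomial.C β) (Polynomial.C ε) (Polynomial.C a)
      (Polynomial.C b) (Polynomial.C c) (Polynomial.C d) Polynomial.X).natDegree = p ^ 4 := by
  have hp := (Fact.out : p.Prime).one_lt
  have l1 : p < p ^ 4 := by simpa using Nat.pow_lt_pow_right hp (show 1 < 4 by norm_num)
  have l2 : p ^ 2 < p ^ 4 := Nat.pow_lt_pow_right hp (by norm_num)
  have l3 : p ^ 3 < p ^ 4 := Nat.pow_lt_pow_right hp (by norm_num)
  have hX : ∀ (e : A) (k : ℕ), k < p ^ 4 →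
      Polynomial.C e * Polynomial.X ^ k ∈ Polynomial.degreeLT A (p ^ 4) := by
    intro e k hk
    rw [Polynomial.mem_degreeLT]
    exact (Polynomial.degree_C_mul_X_pow_le _ _).trans_lt (by exact_mod_cast hk)
  obtain ⟨r, hr, hdeg⟩ : ∃ r : Polynomial A, addPolyQ p (Polynomial.C α) (Polynomial.C β)
      (Polynomial.C ε) (Polynomial.C a) (Polynomial.C b) (Polynomial.C c) (Polynomial.C d)
      Polynomial.X = Polynomial.X ^ p ^ 4 + r ∧ r ∈ Polynomial.degreeLT A (p ^ 4) := by
    have hc3 := hX (-a ^ p - c ^ (p - 1) * β) (p ^ 3) l3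
    have hc2 := hX (b ^ p + c ^ (p - 1) * β * a) (p ^ 2) l2
    have hc1 := hX (d ^ p - c ^ p * α - c ^ (p - 1) * β * b) p l1
    have hc0 := hX (- c ^ p * ε - c ^ (p - 1) * β * d) 1 (hp.trans l1)
    refine ⟨_, ?_, add_mem (add_mem (add_mem hc3 hc2) hc1) hc0⟩
    rw [addPolyQ, addPolyU, add_pow_char, add_pow_char, sub_pow_char, mul_pow, mul_pow, mul_pow]
    simp only [map_add, map_sub, map_mul, map_neg, map_pow]
    ring
  rw [Polynomial.mem_degreeLT] at hdeg
  rw [hr]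
  exact ⟨Polynomial.monic_X_pow_add hdeg, by
    rw [Polynomial.natDegree_add_eq_left_of_degree_lt (by rwa [Polynomial.degree_X_pow]),
      Polynomial.natDegree_X_pow]⟩

end Dehomogenization

/-! ### The dehomogenized invariants lie in F[A, B]. -/

section DehomogenizedInvariants

variable {F : Type*} [Field F] (p : ℕ)

/-- The elimination of `v = c⁻¹ (U(u) - h)` from a polynomial in `u` and `v`: the dehomogenization,
with values in `F[h][u]`. -/
noncomputable def elimHom (a b c d : F) : MvPolynomial (Fin 3) F →ₐ[F] Polynomial (Polynomial F) :=
  aeval ![Polynomial.C (Polynomial.C c⁻¹) * (addPolyU p (Polynomial.C (Polynomial.C a))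
    (Polynomial.C (Polynomial.C b)) (Polynomial.C (Polynomial.C d)) Polynomial.X -
      Polynomial.C Polynomial.X) + Polynomial.X ^ 2, Polynomial.X, 1]

/-- The evaluation `F[h][u] → F[u, v]` at `h = U(u) - c v`. -/
noncomputable def unelimHom (a b c d : F) :
    Polynomial (Polynomial F) →+* MvPolynomial (Fin 3) F :=
  Polynomial.eval₂RingHom (Polynomial.eval₂RingHom C (dehomog (addPolyB p a b c d))) (X 1)

theorem unelimHom_elimHom {a b c d : F} (hc : c ≠ 0) (f : MvPolynomial (Fin 3) F) :
    unelimHom p a b c d (elimHom p a b c d f) = dehomog f := by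
  have hinv : (C c⁻¹ * C c : MvPolynomial (Fin 3) F) = 1 := by
    rw [← C_mul, inv_mul_cancel₀ hc, C_1]
  have h : (unelimHom p a b c d).comp (elimHom p a b c d).toRingHom = dehomog.toRingHom := by
    refine MvPolynomial.ringHom_ext ?_ ?_
    · intro r
      simp [unelimHom, elimHom, dehomog]
    · intro i
      fin_cases i
      · simp [unelimHom, elimHom, dehomog, addPolyU, addPolyB, delta]
        linear_combination X 0 * hinv
      · simp [unelimHom, elimHom, dehomog]
      · simp [unelimHom, elimHom, dehomog]
  exact DFunLike.congr_fun h f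

variable {p} [Fact p.Prime] [CharP F p] (M : Matrix (Fin 2) (Fin 4) F)

/-- Eliminating v in favour of the invariant h = U(u) - cv leaves an action that fixes F[h] and
translates u alone. The check on z rests on U(u + r₀) = U(u) + c r₁, which is additivity of U
combined with `hrel`. -/
theorem elimHom_act {a b c d : F} (hc : c ≠ 0)
    (hrel : ∀ v, rowComb p M 0 v ^ p ^ 3 - a * rowComb p M 0 v ^ p ^ 2 + b * rowComb p M 0 v ^ p -
      c * rowComb p M 1 v + d * rowComb p M 0 v = 0)
    (e : Multiplicative (Fin 4 → ZMod p)) (f : MvPolynomial (Fin 3) F) :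
    elimHom p a b c d (act p M e f) = (elimHom p a b c d f).comp
      (Polynomial.X + Polynomial.C (Polynomial.C (rowComb p M 0 e.toAdd))) := by
  let κ : F →+* Polynomial (Polynomial F) := Polynomial.C.comp Polynomial.C
  have hU : ∀ r : F, κ (addPolyU p a b d r) = addPolyU p (κ a) (κ b) (κ d) (κ r) :=
    fun r => map_addPolyU κ p a b d r
  have hinv : κ c⁻¹ * κ c = 1 := by rw [← map_mul, inv_mul_cancel₀ hc, map_one]
  have hrel' : addPolyU p (κ a) (κ b) (κ d) (κ (rowComb p M 0 e.toAdd)) =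
      κ c * κ (rowComb p M 1 e.toAdd) := by
    rw [← hU, ← map_mul]
    congr 1
    rw [addPolyU]
    linear_combination hrel e.toAdd
  have h : (elimHom p a b c d).toRingHom.comp (act p M e).toRingHom =
      (Polynomial.compRingHom (Polynomial.X + κ (rowComb p M 0 e.toAdd))).comp
        (elimHom p a b c d).toRingHom := by
    refine MvPolynomial.ringHom_ext ?_ ?_
    · intro r
      simp [elimHom, κ]
    · intro i
      fin_cases i
      · change elimHom p a b c d (act p M e (X 0)) = (elimHom p a b c d (X 0)).comp
          (Polynomial.X + κ (rowComb p M 0 e.toAdd))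
        have h1 : (addPolyU p (κ a) (κ b) (κ d) Polynomial.X).comp
            (Polynomial.X + κ (rowComb p M 0 e.toAdd)) =
            addPolyU p (κ a) (κ b) (κ d) Polynomial.X + κ c * κ (rowComb p M 1 e.toAdd) := by
          rw [← hrel', ← addPolyU_add]
          simp [addPolyU, κ]
        have h2 : ∀ r, elimHom p a b c d (C r) = κ r := fun r => (elimHom p a b c d).commutes r
        have h3 : elimHom p a b c d (X 0) =
            κ c⁻¹ * (addPolyU p (κ a) (κ b) (κ d) Polynomial.X - Polynomial.C Polynomial.X) +
              Polynomial.X ^ 2 := by simp [elimHom, κ]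
        have h4 : ∀ r s, (κ r).comp s = κ r := by simp [κ]
        rw [act_X_zero]
        simp only [map_add, map_mul, map_pow, h2, map_ofNat, h3, Polynomial.add_comp, Polynomial.mul_comp,
          Polynomial.sub_comp, h1, h4, Polynomial.C_comp, Polynomial.pow_comp, Polynomial.X_comp]
        simp only [elimHom, aeval_X, Matrix.cons_val]
        linear_combination -κ (rowComb p M 1 e.toAdd) * hinv
      · change elimHom p a b c d (act p M e (X 1)) = (elimHom p a b c d (X 1)).comp
          (Polynomial.X + κ (rowComb p M 0 e.toAdd))
        rw [act_X_one]
        simp [elimHom, κ]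
      · change elimHom p a b c d (act p M e (X 2)) = (elimHom p a b c d (X 2)).comp
          (Polynomial.X + κ (rowComb p M 0 e.toAdd))
        rw [act_X_two]
        simp [elimHom]
  exact DFunLike.congr_fun h f

theorem rowComb_sub (i : Fin 2) (v w : Fin 4 → ZMod p) :
    rowComb p M i (v - w) = rowComb p M i v - rowComb p M i w := by
  simp [rowComb, sub_mul]

/-- In F[h][u] the group acts by p⁴ distinct translations that are precisely the roots of Q, so
`mem_adjoin_of_translation_invariant` puts the invariants in F[h][Q]. Substituting h = B and the
formula for Q lands in F[A, B]. -/
theorem dehomog_mem_adjoin (hodd : Odd p) {α β ε a b c d : F} (hc : c ≠ 0)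
    (hrelA : ∀ v, -rowComb p M 1 v ^ p + α * rowComb p M 0 v ^ p + β * rowComb p M 1 v +
      ε * rowComb p M 0 v = 0)
    (hrelB : ∀ v, rowComb p M 0 v ^ p ^ 3 - a * rowComb p M 0 v ^ p ^ 2 + b * rowComb p M 0 v ^ p -
      c * rowComb p M 1 v + d * rowComb p M 0 v = 0)
    (hinj : ∀ v : Fin 4 → ZMod p, rowComb p M 0 v = 0 → rowComb p M 1 v = 0 → v = 0)
    {f : MvPolynomial (Fin 3) F} (hf : f ∈ invariants p M) :
    dehomog f ∈ Algebra.adjoin F {dehomog (addPolyA p α β ε), dehomog (addPolyB p a b c d)} := by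
  classical
  have hp := (Fact.out : p.Prime)
  rw [← unelimHom_elimHom p hc f (a := a) (b := b) (d := d)]
  obtain ⟨hmonic, hdeg⟩ := monic_addPolyQ (A := Polynomial F) p (Polynomial.C α) (Polynomial.C β)
    (Polynomial.C ε) (Polynomial.C a) (Polynomial.C b) (Polynomial.C c) (Polynomial.C d)
  set q := addPolyQ p (Polynomial.C (Polynomial.C α)) (Polynomial.C (Polynomial.C β))
    (Polynomial.C (Polynomial.C ε)) (Polynomial.C (Polynomial.C a)) (Polynomial.C (Polynomial.C b))
    (Polynomial.C (Polynomial.C c)) (Polynomial.C (Polynomial.C d)) Polynomial.X with hq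
  have hQ : ∀ v, addPolyQ p α β ε a b c d (rowComb p M 0 v) = 0 := by
    intro v
    have hU : addPolyU p a b d (rowComb p M 0 v) - c * rowComb p M 1 v = 0 := by
      rw [addPolyU]
      linear_combination hrelB v
    rw [addPolyQ_eq p (v := rowComb p M 1 v), hU, hrelA v, zero_pow hp.ne_zero]
    ring
  have hroot : ∀ v, q.eval (Polynomial.C (rowComb p M 0 v)) = 0 := by
    intro v
    have h1 := map_addPolyQ (Polynomial.evalRingHom (Polynomial.C (rowComb p M 0 v))) p
      (Polynomial.C (Polynomial.C α)) (Polynomial.C (Polynomial.C β))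
      (Polynomial.C (Polynomial.C ε)) (Polynomial.C (Polynomial.C a))
      (Polynomial.C (Polynomial.C b)) (Polynomial.C (Polynomial.C c))
      (Polynomial.C (Polynomial.C d)) Polynomial.X
    simp only [Polynomial.coe_evalRingHom, Polynomial.eval_C, Polynomial.eval_X] at h1
    rw [hq, h1, ← map_addPolyQ (Polynomial.C : F →+* Polynomial F), hQ, map_zero]
  have hshift : ∀ v, q.comp (Polynomial.X + Polynomial.C (Polynomial.C (rowComb p M 0 v))) = q := by
    intro v
    have h1 := map_addPolyQ (Polynomial.compRingHom
      (Polynomial.X + Polynomial.C (Polynomial.C (rowComb p M 0 v)))) p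
      (Polynomial.C (Polynomial.C α)) (Polynomial.C (Polynomial.C β))
      (Polynomial.C (Polynomial.C ε)) (Polynomial.C (Polynomial.C a))
      (Polynomial.C (Polynomial.C b)) (Polynomial.C (Polynomial.C c))
      (Polynomial.C (Polynomial.C d)) Polynomial.X
    simp only [Polynomial.coe_compRingHom_apply, Polynomial.C_comp, Polynomial.X_comp] at h1
    rw [hq, h1, addPolyQ_add, ← map_addPolyQ (Polynomial.C : Polynomial F →+* _),
      ← map_addPolyQ (Polynomial.C : F →+* Polynomial F), hQ, map_zero, map_zero, add_zero]
  -- The first row alone separates group elements: r₀ = 0 forces c r₁ = 0 by `hrelB`, and c ≠ 0.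
  have hinj' : Function.Injective fun v => (Polynomial.C (rowComb p M 0 v) : Polynomial F) := by
    intro v w hvw
    have h0 : rowComb p M 0 (v - w) = 0 := by
      rw [rowComb_sub, Polynomial.C_injective hvw, sub_self]
    refine sub_eq_zero.mp (hinj _ h0 ?_)
    have := hrelB (v - w)
    simpa [h0, hp.ne_zero, hc] using this
  have hmem := mem_adjoin_of_translation_invariant hmonic (by rw [hdeg]; exact pow_pos hp.pos 4)
    (s := Finset.univ.image fun v => (Polynomial.C (rowComb p M 0 v) : Polynomial F))
    (by rw [Finset.card_image_of_injective _ hinj', hdeg]; simp [ZMod.card])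
    (by simpa using hroot) (by simpa using hshift) (elimHom p a b c d f)
    (by
      simp only [Finset.mem_image, Finset.mem_univ, true_and, forall_exists_index,
        forall_apply_eq_imp_iff]
      intro v
      have := elimHom_act M hc hrelB (Multiplicative.ofAdd v) f
      rw [(mem_invariants p M f).mp hf] at this
      exact this.symm)
  have hA := Algebra.subset_adjoin (R := F) (Set.mem_insert (dehomog (addPolyA p α β ε))
    {dehomog (addPolyB p a b c d)})
  have hB := Algebra.subset_adjoin (R := F) (Set.mem_insert_of_mem (dehomog (addPolyA p α β ε))
    (Set.mem_singleton (dehomog (addPolyB p a b c d))))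
  have hCm : ∀ r : F, C r ∈ Algebra.adjoin F
      {dehomog (addPolyA p α β ε), dehomog (addPolyB p a b c d)} :=
    fun r => Subalgebra.algebraMap_mem _ r
  generalize elimHom p a b c d f = g at hmem
  induction hmem using Algebra.adjoin_induction with
  | mem g hg =>
    rw [Set.mem_singleton_iff] at hg
    rw [hg, hq, map_addPolyQ]
    simp only [unelimHom, Polynomial.coe_eval₂RingHom, Polynomial.eval₂_C, Polynomial.eval₂_X]
    have h1 : addPolyU p (C a) (C b) (C d) (X 1) - C c * X 0 = dehomog (addPolyB p a b c d) := by
      rw [dehomog_addPolyB, addPolyU]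
      ring
    rw [addPolyQ_eq p (v := X 0), h1, ← dehomog_addPolyA hodd, ← C_pow, ← C_pow]
    exact sub_mem (sub_mem (pow_mem hB _) (mul_mem (mul_mem (hCm _) (hCm _)) hB))
      (mul_mem (hCm _) hA)
  | algebraMap r =>
    change unelimHom p a b c d (Polynomial.C r) ∈ _
    rw [unelimHom, Polynomial.coe_eval₂RingHom, Polynomial.eval₂_C]
    induction r using Polynomial.induction_on' with
    | add r s hr hs => rw [map_add]; exact add_mem hr hs
    | monomial n r =>
      simp only [Polynomial.coe_eval₂RingHom, Polynomial.eval₂_monomial]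
      exact mul_mem (hCm _) (pow_mem hB _)
  | add f g _ _ hf hg => rw [map_add]; exact add_mem hf hg
  | mul f g _ _ hf hg => rw [map_mul]; exact mul_mem hf hg

end DehomogenizedInvariants

/-! ### Normal exponents and the arithmetic of lead monomials. -/

section Normal

/-- The degrees of `x, h₁, h₂, h₃, N_M(z)`. -/
def genWeight (p : ℕ) : Fin 5 → ℕ := ![1, 2 * p, p ^ 3, p ^ 3 + 2, p ^ 4]

/-- The exponents of the lead monomials of `x, h₁, h₂, h₃, N_M(z)`. -/
noncomputable def genDegree (p : ℕ) : Fin 5 → Fin 3 →₀ ℕ :=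
  ![Finsupp.single 2 1, Finsupp.single 1 (2 * p), Finsupp.single 1 (p ^ 3),
    Finsupp.single 1 (p ^ 3 + 2), Finsupp.single 0 (p ^ 4)]

/-- The exponents of the lead monomials of the dehomogenizations of `x, h₁, h₂, h₃, N_M(z)`. -/
noncomputable def dehomogDegree (p : ℕ) : Fin 5 → Fin 3 →₀ ℕ :=
  ![0, Finsupp.single 0 p, Finsupp.single 1 (p ^ 3), Finsupp.single 1 (2 * p ^ 3),
    Finsupp.single 1 (2 * p ^ 4)]

/-- The exponents of power products of `x, h₁, h₂, h₃, N_M(z)` that are not divisible by `h₂²` or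
`h₃^p`. -/
def normalExponents (p : ℕ) : Set (Fin 5 →₀ ℕ) := {I | I 2 < 2 ∧ I 3 < p}

theorem sum_smul_genDegree (p : ℕ) (I : Fin 5 →₀ ℕ) :
    (∑ i, I i • genDegree p i) 0 = p ^ 4 * I 4 ∧
    (∑ i, I i • genDegree p i) 1 = 2 * p * I 1 + p ^ 3 * I 2 + (p ^ 3 + 2) * I 3 ∧
    (∑ i, I i • genDegree p i) 2 = I 0 := by
  refine ⟨?_, ?_, ?_⟩
  · simp [Fin.sum_univ_five, genDegree, mul_comm]
  · simp [Fin.sum_univ_five, genDegree]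
    ring
  · simp [Fin.sum_univ_five, genDegree]

theorem sum_smul_dehomogDegree (p : ℕ) (I : Fin 5 →₀ ℕ) :
    (∑ i, I i • dehomogDegree p i) 0 = p * I 1 ∧
    (∑ i, I i • dehomogDegree p i) 1 = p ^ 3 * (I 2 + 2 * (I 3 + p * I 4)) ∧
    (∑ i, I i • dehomogDegree p i) 2 = 0 := by
  refine ⟨?_, ?_, ?_⟩
  · simp [Fin.sum_univ_five, dehomogDegree, mul_comm]
  · simp [Fin.sum_univ_five, dehomogDegree]
    ring
  · simp [Fin.sum_univ_five, dehomogDegree]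

/-- The exponents of x and z give I 0 and I 4. The exponent of y is 2 · I 3 modulo p, which fixes I
3 < p since p is odd. What remains, divided by p, is 2 · I 1 + p² · I 2, and its parity fixes I 2 <
2. -/
theorem injOn_sum_smul_genDegree {p : ℕ} (hp : p.Prime) (hodd : Odd p) :
    Set.InjOn (fun I : Fin 5 →₀ ℕ => ∑ i, I i • genDegree p i) (normalExponents p) := by
  intro I hI J hJ h
  obtain ⟨hI2, hI3⟩ := hI
  obtain ⟨hJ2, hJ3⟩ := hJ
  simp only at h
  obtain ⟨i0, i1, i2⟩ := sum_smul_genDegree p I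
  obtain ⟨j0, j1, j2⟩ := sum_smul_genDegree p J
  rw [h] at i0 i1 i2
  have h0 : I 0 = J 0 := i2.symm.trans j2
  have h4 : I 4 = J 4 := Nat.eq_of_mul_eq_mul_left (pow_pos hp.pos 4) (i0.symm.trans j0)
  have h1 := i1.symm.trans j1
  have h3 : I 3 = J 3 := by
    have hmod : 2 * I 3 ≡ 2 * J 3 [MOD p] := by
      have a1 : (2 * p * I 1 + p ^ 3 * I 2 + (p ^ 3 + 2) * I 3) ≡ 2 * I 3 [MOD p] := by
        rw [show 2 * p * I 1 + p ^ 3 * I 2 + (p ^ 3 + 2) * I 3 =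
          2 * I 3 + p * (2 * I 1 + p ^ 2 * I 2 + p ^ 2 * I 3) by ring]
        simp [Nat.ModEq]
      have a2 : (2 * p * J 1 + p ^ 3 * J 2 + (p ^ 3 + 2) * J 3) ≡ 2 * J 3 [MOD p] := by
        rw [show 2 * p * J 1 + p ^ 3 * J 2 + (p ^ 3 + 2) * J 3 =
          2 * J 3 + p * (2 * J 1 + p ^ 2 * J 2 + p ^ 2 * J 3) by ring]
        simp [Nat.ModEq]
      rw [h1] at a1
      exact a1.symm.trans a2
    have := Nat.ModEq.cancel_left_of_coprime
      (show Nat.gcd p 2 = 1 from Nat.coprime_two_right.mpr hodd) hmod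
    rwa [Nat.ModEq, Nat.mod_eq_of_lt hI3, Nat.mod_eq_of_lt hJ3] at this
  have h12 : 2 * I 1 + p ^ 2 * I 2 = 2 * J 1 + p ^ 2 * J 2 := by
    refine Nat.eq_of_mul_eq_mul_left hp.pos ?_
    rw [h3] at h1
    linarith
  have h2 : I 2 = J 2 := by
    obtain ⟨k, hk⟩ := hodd.pow (n := 2)
    have e1 : I 2 = 0 ∨ I 2 = 1 := by omega
    have e2 : J 2 = 0 ∨ J 2 = 1 := by omega
    rcases e1 with e1 | e1 <;> rcases e2 with e2 | e2 <;> rw [e1, e2] at h12 ⊢ <;> omega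
  have h1' : I 1 = J 1 := by
    rw [h2] at h12
    omega
  ext i
  fin_cases i
  · exact h0
  · exact h1'
  · exact h2
  · exact h3
  · exact h4

end Normal

/-! ### Normal power products span the invariants; the SAGBI basis. -/

/-- The properties of `h = (x, h₁, h₂, h₃, N_M(z))` from which it follows that `h` is a SAGBI basis
for `A`. -/
structure IsGeneratorFamily {F : Type*} [Field F] (p : ℕ)
    (A : Subalgebra F (MvPolynomial (Fin 3) F)) (h : Fin 5 → MvPolynomial (Fin 3) F) : Prop where
  prime : p.Prime
  odd : Odd p
  apply_zero : h 0 = X 2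
  mem : ∀ i, h i ∈ A
  homogeneous : ∀ i, (h i).IsHomogeneous (genWeight p i)
  monic : ∀ i, grevlex.Monic (h i)
  degree : ∀ i, grevlex.degree (h i) = genDegree p i
  dehomog_ne_zero : ∀ i, dehomog (h i) ≠ 0
  dehomog_degree : ∀ i, grevlex.degree (dehomog (h i)) = dehomogDegree p i
  component_mem : ∀ f ∈ A, ∀ n, homogeneousComponent n f ∈ A
  dehomog_mem : ∀ f ∈ A, dehomog f ∈ Algebra.adjoin F {dehomog (h 1), dehomog (h 2)}

namespace IsGeneratorFamily

variable {F : Type*} [Field F] {p : ℕ} {A : Subalgebra F (MvPolynomial (Fin 3) F)}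
  {h : Fin 5 → MvPolynomial (Fin 3) F}

theorem ne_zero (H : IsGeneratorFamily p A h) (i : Fin 5) : h i ≠ 0 := (H.monic i).ne_zero

theorem degree_powerProduct (H : IsGeneratorFamily p A h) (I : Fin 5 →₀ ℕ) :
    grevlex.degree (powerProduct h I) = ∑ i, I i • genDegree p i := by
  rw [_root_.degree_powerProduct h grevlex H.ne_zero]
  simp only [H.degree]

theorem dehomog_powerProduct (I : Fin 5 →₀ ℕ) :
    dehomog (powerProduct h I) = powerProduct (fun i => dehomog (h i)) I := by
  simp [powerProduct]

theorem injOn_degree (H : IsGeneratorFamily p A h) :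
    Set.InjOn (fun I => grevlex.degree (powerProduct h I)) (normalExponents p) := by
  simp only [H.degree_powerProduct]
  exact injOn_sum_smul_genDegree H.prime H.odd

/-- The lead monomials of elements of the algebra generated by the dehomogenizations of `h₁` and
`h₂`. -/
theorem exists_degree_of_mem_adjoin (H : IsGeneratorFamily p A h) {f : MvPolynomial (Fin 3) F}
    (hf : f ∈ Algebra.adjoin F {dehomog (h 1), dehomog (h 2)}) (hf0 : f ≠ 0) :
    ∃ i j, grevlex.degree f = Finsupp.single 0 (p * i) + Finsupp.single 1 (p ^ 3 * j) := by
  have hrange : ({dehomog (h 1), dehomog (h 2)} : Set (MvPolynomial (Fin 3) F)) =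
      Set.range ![dehomog (h 1), dehomog (h 2)] := by simp [Set.pair_comm]
  rw [hrange, Algebra.adjoin_range_eq_range_aeval] at hf
  obtain ⟨P, rfl⟩ := hf
  have hdeg : ∀ I, grevlex.degree (powerProduct ![dehomog (h 1), dehomog (h 2)] I) =
      Finsupp.single 0 (p * I 0) + Finsupp.single 1 (p ^ 3 * I 1) := by
    intro I
    rw [_root_.degree_powerProduct]
    · simp [Fin.sum_univ_two, H.dehomog_degree, dehomogDegree, mul_comm]
    · intro i
      fin_cases i <;> simp [H.dehomog_ne_zero]
  obtain ⟨I, -, hI, -⟩ := exists_degree_aeval ![dehomog (h 1), dehomog (h 2)] grevlex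
    (by intro i; fin_cases i <;> simp [H.dehomog_ne_zero]) (S := Set.univ)
    (by
      intro I _ J _ hIJ
      simp only [hdeg] at hIJ
      have h0 := DFunLike.congr_fun hIJ 0
      have h1 := DFunLike.congr_fun hIJ 1
      simp [H.prime.ne_zero] at h0 h1
      ext i
      fin_cases i
      · exact h0
      · exact h1)
    (P := P) (by rintro rfl; exact hf0 (map_zero _)) (fun _ _ => trivial)
  exact ⟨_, _, hI.trans (hdeg I)⟩

/-- Subduction after x = 1: every possible lead monomial v^(pi) u^(p³j) is attained by a normal
power product, and subtracting a multiple of it lowers the lead monomial. -/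
theorem exists_normal_of_mem_adjoin (H : IsGeneratorFamily p A h) (f : MvPolynomial (Fin 3) F)
    (hf : f ∈ Algebra.adjoin F {dehomog (h 1), dehomog (h 2)}) :
    ∃ P ∈ restrictSupport F (normalExponents p), aeval (fun i => dehomog (h i)) P = f := by
  induction hs : grevlex.toSyn (grevlex.degree f) using WellFoundedLT.induction generalizing f with
  | ind s ih =>
    by_cases hf0 : f = 0
    · exact ⟨0, zero_mem _, by rw [hf0, map_zero]⟩
    obtain ⟨i, j, hij⟩ := H.exists_degree_of_mem_adjoin hf hf0
    -- The images of h₂, h₃, N_M(z) have lead monomials u^(p³) to the powers 1, 2, 2p, so j is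
    -- written in the mixed radix system with digits below 2, below p, and unbounded.
    let I : Fin 5 →₀ ℕ := Finsupp.equivFunOnFinite.symm ![0, i, j % 2, j / 2 % p, j / 2 / p]
    have hI : I ∈ normalExponents p := ⟨Nat.mod_lt _ two_pos, Nat.mod_lt _ H.prime.pos⟩
    let g := powerProduct (fun i => dehomog (h i)) I
    have hg0 : g ≠ 0 := powerProduct_ne_zero _ H.dehomog_ne_zero I
    have hg : grevlex.degree f = grevlex.degree g := by
      rw [hij, _root_.degree_powerProduct _ _ H.dehomog_ne_zero]
      simp only [H.dehomog_degree]
      obtain ⟨e0, e1, e2⟩ := sum_smul_dehomogDegree p I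
      have hj : j % 2 + 2 * (j / 2 % p + p * (j / 2 / p)) = j := by
        rw [Nat.mod_add_div, Nat.mod_add_div]
      ext k
      fin_cases k
      · exact (by simp : _ = p * i).trans e0.symm
      · refine (by simp : _ = p ^ 3 * j).trans (Eq.trans ?_ e1.symm)
        rw [← hj]
        rfl
      · exact (by simp : _ = 0).trans e2.symm
    set c := grevlex.leadingCoeff f / grevlex.leadingCoeff g
    have hlt := leadingTerm_eq_of_degree_eq grevlex hg0 hg
    have hgmem : g ∈ Algebra.adjoin F {dehomog (h 1), dehomog (h 2)} :=
      prod_mem fun i _ => pow_mem (H.dehomog_mem _ (H.mem i)) _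
    have hmem : f - C c * g ∈ Algebra.adjoin F {dehomog (h 1), dehomog (h 2)} :=
      sub_mem hf (mul_mem (Subalgebra.algebraMap_mem _ c) hgmem)
    have hmono : ∀ r : F, monomial I r ∈ restrictSupport F (normalExponents p) :=
      fun r => (monomial_mem_restrictSupport F).mpr (Or.inl hI)
    obtain ⟨P, hP, hPf⟩ : ∃ P ∈ restrictSupport F (normalExponents p),
        aeval (fun i => dehomog (h i)) P = f - C c * g := by
      by_cases h0 : f - C c * g = 0
      · exact ⟨0, zero_mem _, by rw [h0, map_zero]⟩
      · refine ih _ ?_ _ hmem rfl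
        rw [← hs]
        exact degree_sub_lt_of_leadingTerm_eq grevlex hlt h0
    refine ⟨monomial I c + P, add_mem (hmono c) hP, ?_⟩
    rw [map_add, hPf, aeval_monomial_eq_powerProduct]
    ring

/-- The normal expression found after x = 1 is homogenized by padding each power product with a
power of x, which does not affect normality. The two sides are homogeneous of the same degree and
agree at x = 1. -/
theorem exists_X_pow_mul_eq (H : IsGeneratorFamily p A h) {f : MvPolynomial (Fin 3) F} {n : ℕ}
    (hf : f ∈ A) (hfn : f.IsHomogeneous n) :
    ∃ k, ∃ P ∈ restrictSupport F (normalExponents p), X 2 ^ k * f = aeval h P := by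
  obtain ⟨P, hP, hPf⟩ := H.exists_normal_of_mem_adjoin _ (H.dehomog_mem f hf)
  -- The weights can exceed n, so f is multiplied by x^d with d their maximum; the truncated
  -- subtractions below are then exact.
  let d := P.support.sup fun I => Finsupp.weight (genWeight p) I
  let Q : MvPolynomial (Fin 5) F := ∑ I ∈ P.support,
    monomial (Finsupp.single 0 (d + n - Finsupp.weight (genWeight p) I) + I) (P.coeff I)
  have hQ : aeval h Q = ∑ I ∈ P.support,
      C (P.coeff I) * (X 2 ^ (d + n - Finsupp.weight (genWeight p) I) * powerProduct h I) := by
    rw [map_sum]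
    refine Finset.sum_congr rfl fun I _ => ?_
    rw [aeval_monomial_eq_powerProduct, powerProduct_add, powerProduct_single, H.apply_zero]
  refine ⟨d, Q, ?_, ?_⟩
  · refine sum_mem fun I hI => (monomial_mem_restrictSupport F).mpr (Or.inl ?_)
    have := (mem_restrictSupport_iff F).mp hP hI
    simpa [normalExponents] using this
  · rw [← sub_eq_zero]
    refine eq_zero_of_dehomogenize_eq_zero (n := d + n) ?_ ?_
    · refine IsHomogeneous.sub ((isHomogeneous_X_pow _ _).mul hfn) ?_
      rw [hQ]
      refine IsHomogeneous.sum _ _ _ fun I hI => ?_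
      have hle : Finsupp.weight (genWeight p) I ≤ d :=
        Finset.le_sup (f := fun I => Finsupp.weight (genWeight p) I) hI
      have := ((isHomogeneous_X_pow (R := F) 2 (d + n - Finsupp.weight (genWeight p) I)).mul
        (isHomogeneous_powerProduct h H.homogeneous I)).C_mul (P.coeff I)
      rwa [Nat.sub_add_cancel (hle.trans (Nat.le_add_right _ _))] at this
    · change dehomog (X 2 ^ d * f - aeval h Q) = 0
      rw [map_sub, map_mul, map_pow, dehomog_X_two, one_pow, one_mul, hQ, map_sum, ← hPf,
        aeval_eq_sum_powerProduct, sub_eq_zero]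
      refine Finset.sum_congr rfl fun I _ => ?_
      rw [map_mul, map_mul, map_pow, dehomog_X_two, one_pow, one_mul, dehomog_C,
        dehomog_powerProduct]

/-- The part R of P free of the variable for x maps to a multiple of x. If R ≠ 0, absence of
cancellation gives its image a lead monomial without x, a contradiction; so P is divisible by that
variable. -/
theorem exists_of_X_mul_eq (H : IsGeneratorFamily p A h) {f : MvPolynomial (Fin 3) F}
    {P : MvPolynomial (Fin 5) F} (hP : P ∈ restrictSupport F (normalExponents p))
    (hf : X 2 * f = aeval h P) :
    ∃ Q ∈ restrictSupport F (normalExponents p), f = aeval h Q := by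
  let Q := P.divMonomial (Finsupp.single 0 1)
  let R := P.modMonomial (Finsupp.single 0 1)
  have hsum : X 0 * Q + R = P := divMonomial_add_modMonomial_single P 0
  have hRsupp : ∀ I ∈ R.support, I 0 = 0 ∧ I ∈ normalExponents p := by
    intro I hI
    rw [mem_support_iff] at hI
    have h0 : ¬ Finsupp.single 0 1 ≤ I := fun hle => hI (coeff_modMonomial_of_le P hle)
    refine ⟨?_, (mem_restrictSupport_iff F).mp hP (mem_support_iff.mpr ?_)⟩
    · rw [Finsupp.single_le_iff] at h0
      omega
    · rwa [coeff_modMonomial_of_not_le P h0] at hI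
  have hQ : Q ∈ restrictSupport F (normalExponents p) := by
    rw [mem_restrictSupport_iff F]
    intro I hI
    have hI' := mem_support_iff.mp hI
    rw [coeff_divMonomial] at hI'
    have := (mem_restrictSupport_iff F).mp hP (mem_support_iff.mpr hI')
    simpa [normalExponents] using this
  refine ⟨Q, hQ, ?_⟩
  have hX : aeval h (X 0 : MvPolynomial (Fin 5) F) = (X 2 : MvPolynomial (Fin 3) F) := by rw [aeval_X, H.apply_zero]
  rw [← hsum, map_add, map_mul, hX] at hf
  by_cases hR : R = 0
  · rw [hR, map_zero, add_zero] at hf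
    exact mul_left_cancel₀ (X_ne_zero 2) hf
  · exfalso
    obtain ⟨I, hI, hdeg, hne⟩ := exists_degree_aeval h grevlex H.ne_zero H.injOn_degree hR
      (fun I hI => (hRsupp I hI).2)
    have hf' : aeval h R = X 2 * (f - aeval h Q) := by linear_combination -hf
    rw [H.degree_powerProduct] at hdeg
    have h2 : grevlex.degree (aeval h R) 2 = 0 := by
      rw [hdeg, (sum_smul_genDegree p I).2.2, (hRsupp I hI).1]
    rw [hf'] at hne h2
    rw [grevlex.degree_mul (left_ne_zero_of_mul hne) (right_ne_zero_of_mul hne),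
      MonomialOrder.degree_X] at h2
    simp at h2

theorem exists_normal (H : IsGeneratorFamily p A h) {f : MvPolynomial (Fin 3) F} (hf : f ∈ A) :
    ∃ P ∈ restrictSupport F (normalExponents p), f = aeval h P := by
  have hhom : ∀ n, ∃ P ∈ restrictSupport F (normalExponents p),
      homogeneousComponent n f = aeval h P := by
    intro n
    obtain ⟨k, hk⟩ := H.exists_X_pow_mul_eq (H.component_mem f hf n)
      (homogeneousComponent_isHomogeneous n f)
    induction k with
    | zero => simpa using hk
    | succ k ih =>
      obtain ⟨P, hP, hPf⟩ := hk
      refine ih ?_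
      rw [pow_succ', mul_assoc] at hPf
      exact H.exists_of_X_mul_eq hP hPf
  choose P hP hPf using hhom
  refine ⟨∑ n ∈ Finset.range (f.totalDegree + 1), P n, sum_mem fun n _ => hP n, ?_⟩
  rw [map_sum]
  simp only [← hPf]
  exact (sum_homogeneousComponent f).symm

/-- The lead monomial of an element of `A` is the lead monomial of a power product. -/
theorem exists_degree_eq (H : IsGeneratorFamily p A h) {f : MvPolynomial (Fin 3) F} (hf : f ∈ A)
    (hf0 : f ≠ 0) : ∃ I, grevlex.degree f = grevlex.degree (powerProduct h I) := by
  obtain ⟨P, hP, rfl⟩ := H.exists_normal hf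
  obtain ⟨I, -, hI, -⟩ := exists_degree_aeval h grevlex H.ne_zero H.injOn_degree
    (by rintro rfl; exact hf0 (map_zero _)) hP
  exact ⟨I, hI⟩

theorem adjoin_eq (H : IsGeneratorFamily p A h) : Algebra.adjoin F (Set.range h) = A := by
  refine le_antisymm (Algebra.adjoin_le ?_) fun f hf => ?_
  · rintro _ ⟨i, rfl⟩
    exact H.mem i
  · obtain ⟨P, -, rfl⟩ := H.exists_normal hf
    rw [Algebra.adjoin_range_eq_range_aeval]
    exact ⟨P, rfl⟩

theorem isSagbiBasis (H : IsGeneratorFamily p A h) : IsSagbiBasis (Set.range h) A := by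
  have hsub : Set.range h ⊆ A := by
    rintro _ ⟨i, rfl⟩
    exact H.mem i
  refine ⟨hsub, le_antisymm (Algebra.adjoin_mono ?_) (Algebra.adjoin_le ?_)⟩
  · rintro _ ⟨f, hf, hf0, rfl⟩
    exact ⟨f, hsub hf, hf0, rfl⟩
  · rintro _ ⟨f, hf, hf0, rfl⟩
    obtain ⟨I, hI⟩ := H.exists_degree_eq hf hf0
    have : leadMonomial f = ∏ i, leadMonomial (h i) ^ I i := by
      simp only [leadMonomial, monomial_pow, one_pow, hI]
      rw [_root_.degree_powerProduct h grevlex H.ne_zero, monomial_sum_one]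
    rw [this]
    refine prod_mem fun i _ => pow_mem (Algebra.subset_adjoin ?_) _
    exact ⟨h i, ⟨i, rfl⟩, H.ne_zero i, rfl⟩

theorem powerProduct_mem (H : IsGeneratorFamily p A h) (I : Fin 5 →₀ ℕ) : powerProduct h I ∈ A :=
  prod_mem fun i _ => pow_mem (H.mem i) _

/-- Each step stays in A, so a next power product always exists, and it lowers the lead monomial;
termination is the well-foundedness of the order. -/
theorem exists_subductsToZero (H : IsGeneratorFamily p A h) (f : MvPolynomial (Fin 3) F)
    (hf : f ∈ A) : ∃ P, SubductsToZero h f P := by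
  induction hs : grevlex.toSyn (grevlex.degree f) using WellFoundedLT.induction generalizing f with
  | ind s ih =>
    by_cases hf0 : f = 0
    · exact ⟨0, hf0 ▸ SubductsToZero.zero⟩
    obtain ⟨I, hI⟩ := H.exists_degree_eq hf hf0
    have hlt := leadingTerm_eq_of_degree_eq grevlex (powerProduct_ne_zero h H.ne_zero I) hI
    set c := grevlex.leadingCoeff f / grevlex.leadingCoeff (powerProduct h I)
    obtain ⟨P, hP⟩ : ∃ P, SubductsToZero h (f - C c * powerProduct h I) P := by
      by_cases h0 : f - C c * powerProduct h I = 0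
      · exact ⟨0, h0 ▸ SubductsToZero.zero⟩
      · refine ih _ ?_ _ (sub_mem hf
          (mul_mem (Subalgebra.algebraMap_mem _ c) (H.powerProduct_mem I))) rfl
        rw [← hs]
        exact degree_sub_lt_of_leadingTerm_eq grevlex hlt h0
    exact ⟨_, SubductsToZero.step f I c P hf0 hlt hP⟩

theorem leadingTerm_powerProduct (H : IsGeneratorFamily p A h) (I : Fin 5 →₀ ℕ) :
    grevlex.leadingTerm (powerProduct h I) = monomial (∑ i, I i • genDegree p i) 1 := by
  rw [MonomialOrder.leadingTerm, leadingCoeff_powerProduct h grevlex H.monic,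
    H.degree_powerProduct]

theorem exists_isTatRelation (H : IsGeneratorFamily p A h) {I J : Fin 5 →₀ ℕ}
    (hIJ : ∑ i, I i • genDegree p i = ∑ i, J i • genDegree p i) :
    ∃ r, IsTatRelation h I J r := by
  obtain ⟨P, hP⟩ := H.exists_subductsToZero (powerProduct h I - C 1 * powerProduct h J)
    (sub_mem (H.powerProduct_mem I) (mul_mem (Subalgebra.algebraMap_mem _ 1) (H.powerProduct_mem J)))
  refine ⟨_, 1, P, ?_, hP, rfl⟩
  rw [C_1, one_mul, H.leadingTerm_powerProduct, H.leadingTerm_powerProduct, hIJ]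

end IsGeneratorFamily

/-! ### A monomial order on the presentation ring. -/

section TatOrder

/-- The monomial order defined by an injective additive map to a well-ordered monoid. -/
noncomputable def monomialOrderOfInjective {σ L : Type*} [AddCommMonoid L] [LinearOrder L]
    [IsOrderedAddMonoid L] [WellFoundedLT L] (key : (σ →₀ ℕ) →+ L)
    (hinj : Function.Injective key) (hpos : ∀ a, 0 ≤ key a) : MonomialOrder σ where
  syn := σ →₀ ℕ
  addCommMonoidSyn := inferInstance
  linearOrderSyn := LinearOrder.lift' key hinj
  isOrderedAddMonoid_syn :=
    @IsOrderedAddMonoid.mk _ _ (LinearOrder.lift' key hinj).toPreorder (fun a b h c => by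
      change key (a + c) ≤ key (b + c)
      rw [map_add, map_add]
      exact add_le_add_left (show key a ≤ key b from h) _)
      (fun a b h c => by
      change key (c + a) ≤ key (c + b)
      rw [map_add, map_add]
      exact add_le_add_right (show key a ≤ key b from h) _)
  toSyn := AddEquiv.refl _
  toSyn_monotone := by
    intro a b h
    change key a ≤ key b
    obtain ⟨c, rfl⟩ := le_iff_exists_add.mp h
    rw [map_add]
    exact le_add_of_nonneg_right (hpos c)
  wellFoundedLT_syn := ⟨InvImage.wf key wellFounded_lt⟩

/-- The lead monomial of `h^I`, the exponent of `h₃` and the exponent of `h₂`, compared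
lexicographically. -/
noncomputable def tatKey (p : ℕ) : (Fin 5 →₀ ℕ) →+ grevlex.syn ×ₗ ℕ ×ₗ ℕ where
  toFun I := toLex (grevlex.toSyn (∑ i, I i • genDegree p i), toLex (I 3, I 2))
  map_zero' := by
    simp
  map_add' I J := by
    simp only [Finsupp.add_apply, add_smul, Finset.sum_add_distrib, map_add]
    rfl

theorem tatKey_lt_iff (p : ℕ) (I J : Fin 5 →₀ ℕ) : tatKey p I < tatKey p J ↔
    grevlex.toSyn (∑ i, I i • genDegree p i) < grevlex.toSyn (∑ i, J i • genDegree p i) ∨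
    (∑ i, I i • genDegree p i = ∑ i, J i • genDegree p i ∧ (I 3 < J 3 ∨ I 3 = J 3 ∧ I 2 < J 2)) := by
  change toLex _ < toLex _ ↔ _
  simp only [Prod.Lex.toLex_lt_toLex, EmbeddingLike.apply_eq_iff_eq]

/-- The key contains I 3 and I 2, the lead monomial gives I 0 and I 4, and the exponent of y then
leaves only I 1 = J 1. -/
theorem tatKey_injective {p : ℕ} (hp : 0 < p) : Function.Injective (tatKey p) := by
  intro I J h
  change toLex _ = toLex _ at h
  simp only [EmbeddingLike.apply_eq_iff_eq, Prod.mk.injEq] at h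
  obtain ⟨h, h3, h2⟩ := h
  obtain ⟨i0, i1, i2⟩ := sum_smul_genDegree p I
  obtain ⟨j0, j1, j2⟩ := sum_smul_genDegree p J
  rw [h] at i0 i1 i2
  have h0 : I 0 = J 0 := i2.symm.trans j2
  have h4 : I 4 = J 4 := Nat.eq_of_mul_eq_mul_left (pow_pos hp 4) (i0.symm.trans j0)
  have h1 := i1.symm.trans j1
  rw [h2, h3] at h1
  have h1' : I 1 = J 1 := by
    refine Nat.eq_of_mul_eq_mul_left (show 0 < 2 * p by omega) ?_
    omega
  ext i
  fin_cases i
  · exact h0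
  · exact h1'
  · exact h2
  · exact h3
  · exact h4

/-- The monomial order on the presentation ring for which the lead monomials of the relations
between `x, h₁, h₂, h₃, N_M(z)` are the monomials in `h₂²` and `h₃^p`. -/
noncomputable def tatOrder {p : ℕ} (hp : 0 < p) : MonomialOrder (Fin 5) :=
  monomialOrderOfInjective (tatKey p) (tatKey_injective hp) fun a => by
    rw [← not_lt, ← map_zero (tatKey p), tatKey_lt_iff]
    simp [← MonomialOrder.bot_eq_zero]

theorem tatOrder_lt_iff {p : ℕ} (hp : 0 < p) (I J : Fin 5 →₀ ℕ) :
    (tatOrder hp).toSyn I < (tatOrder hp).toSyn J ↔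
    grevlex.toSyn (∑ i, I i • genDegree p i) < grevlex.toSyn (∑ i, J i • genDegree p i) ∨
    (∑ i, I i • genDegree p i = ∑ i, J i • genDegree p i ∧ (I 3 < J 3 ∨ I 3 = J 3 ∧ I 2 < J 2)) :=
  tatKey_lt_iff p I J

end TatOrder

theorem MvPolynomial.IsHomogeneous.degree_degree {F : Type*} [Field F] {f : MvPolynomial (Fin 3) F} {n : ℕ}
    (hf : f.IsHomogeneous n) (hf0 : f ≠ 0) (m : MonomialOrder (Fin 3)) :
    (m.degree f).degree = n := by
  have := hf (m.coeff_degree_ne_zero_iff.mpr hf0)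
  rw [Finsupp.degree_eq_weight_one]
  exact this

/-- Lead monomials do not increase along a subduction. Each subtracted product shares its lead
monomial with the current polynomial, so for homogeneous input it has the same degree. -/
theorem SubductsToZero.spec {F : Type*} [Field F] {ℓ : ℕ} {h : Fin ℓ → MvPolynomial (Fin 3) F}
    (hne : ∀ i, h i ≠ 0) {w : Fin ℓ → ℕ} (hw : ∀ i, (h i).IsHomogeneous (w i))
    {f : MvPolynomial (Fin 3) F} {P : MvPolynomial (Fin ℓ) F} (H : SubductsToZero h f P) :
    aeval h P = f ∧
    (∀ K ∈ P.support,
      grevlex.toSyn (grevlex.degree (powerProduct h K)) ≤ grevlex.toSyn (grevlex.degree f)) ∧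
    ∀ n, f.IsHomogeneous n → P.IsWeightedHomogeneous w n := by
  classical
  induction H with
  | zero => exact ⟨map_zero _, by simp, fun n _ => isWeightedHomogeneous_zero F w n⟩
  | step f I c P hf hlt hP ih =>
    obtain ⟨ih1, ih2, ih3⟩ := ih
    have hg := powerProduct_ne_zero h hne I
    have hc : c ≠ 0 := by
      rintro rfl
      rw [C_0, zero_mul, MonomialOrder.leadingTerm_zero, MonomialOrder.leadingTerm_eq_zero_iff] at hlt
      exact hf hlt
    have hd : grevlex.degree f = grevlex.degree (C c * powerProduct h I) := by
      rw [← grevlex.degree_leadingTerm f, hlt, grevlex.degree_leadingTerm]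
    have hd' : grevlex.degree f = grevlex.degree (powerProduct h I) := by
      rw [hd, grevlex.degree_mul (C_ne_zero.mpr hc) hg, grevlex.degree_C, zero_add]
    refine ⟨?_, ?_, ?_⟩
    · rw [map_add, ih1, aeval_monomial_eq_powerProduct]
      ring
    · intro K hK
      rcases Finset.mem_union.mp (support_add hK) with hK | hK
      · have := Finset.mem_singleton.mp (support_monomial_subset hK)
        rw [this, hd']
      · refine (ih2 K hK).trans (grevlex.degree_sub_le.trans ?_)
        rw [← hd, sup_idem]
    · intro n hn
      have hwI := isHomogeneous_powerProduct h hw I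
      have hIn : Finsupp.weight w I = n := by
        rw [← hn.degree_degree hf grevlex, hd', hwI.degree_degree hg grevlex]
      refine (isWeightedHomogeneous_monomial w I c hIn).add (ih3 n (hn.sub ?_))
      rw [← hIn]
      exact hwI.C_mul c

theorem SubductsToZero.eq_zero {F : Type*} [Field F] {ℓ : ℕ} {h : Fin ℓ → MvPolynomial (Fin 3) F}
    {P : MvPolynomial (Fin ℓ) F} (H : SubductsToZero h 0 P) : P = 0 := by
  cases H with
  | zero => rfl
  | step f I c P hf => exact absurd rfl hf

namespace IsGeneratorFamily

variable {F : Type*} [Field F] {p : ℕ} {A : Subalgebra F (MvPolynomial (Fin 3) F)}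
  {h : Fin 5 → MvPolynomial (Fin 3) F}

/-- Terms of the subduction have smaller lead monomials than h^I, while h^J ties with h^I and loses
by the tie-break `hlt`. So X^I is the leading term of r in `tatOrder`. -/
theorem tatRelation_spec (H : IsGeneratorFamily p A h) {I J : Fin 5 →₀ ℕ}
    (hI : I ≠ 0) (hIJ : ∑ i, I i • genDegree p i = ∑ i, J i • genDegree p i)
    (hlt : J 3 < I 3 ∨ J 3 = I 3 ∧ J 2 < I 2) {r : MvPolynomial (Fin 5) F}
    (hr : IsTatRelation h I J r) :
    aeval h r = 0 ∧ (tatOrder H.prime.pos).degree r = I ∧ (tatOrder H.prime.pos).Monic r ∧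
      r.IsWeightedHomogeneous (genWeight p) (Finsupp.weight (genWeight p) I) := by
  classical
  obtain ⟨c, P, hc, hP, rfl⟩ := hr
  -- All generators are monic, which leaves no other scalar.
  have hc1 : c = 1 := by
    rw [leadingTerm_C_mul, H.leadingTerm_powerProduct, H.leadingTerm_powerProduct, C_mul_monomial,
      mul_one, hIJ] at hc
    have := congrArg (coeff (∑ i, J i • genDegree p i)) hc
    simpa [eq_comm] using this
  obtain ⟨h1, h2, h3⟩ := hP.spec H.ne_zero H.homogeneous
  have hwI := isHomogeneous_powerProduct h H.homogeneous I
  have hwJ := isHomogeneous_powerProduct h H.homogeneous J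
  have hw : Finsupp.weight (genWeight p) J = Finsupp.weight (genWeight p) I := by
    rw [← hwI.degree_degree (powerProduct_ne_zero h H.ne_zero I) grevlex,
      ← hwJ.degree_degree (powerProduct_ne_zero h H.ne_zero J) grevlex, H.degree_powerProduct,
      H.degree_powerProduct, hIJ]
  have hPI : ∀ K ∈ P.support, (tatOrder H.prime.pos).toSyn K < (tatOrder H.prime.pos).toSyn I := by
    intro K hK
    rw [tatOrder_lt_iff]
    left
    rw [← H.degree_powerProduct, ← H.degree_powerProduct]
    refine (h2 K hK).trans_lt (degree_sub_lt_of_leadingTerm_eq grevlex hc fun h0 => ?_)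
    -- If h^I and c · h^J coincide, the subduction is empty and P has no terms to bound.
    rw [h0] at hP
    rw [hP.eq_zero] at hK
    simp at hK
  have hJI : (tatOrder H.prime.pos).toSyn J < (tatOrder H.prime.pos).toSyn I := by
    rw [tatOrder_lt_iff]
    exact Or.inr ⟨hIJ.symm, hlt⟩
  have hdeg : (tatOrder H.prime.pos).degree (monomial I (1 : F)) = I := by
    rw [MonomialOrder.degree_monomial, if_neg one_ne_zero]
  have hlt' : (tatOrder H.prime.pos).toSyn ((tatOrder H.prime.pos).degree (monomial J c + P)) <
      (tatOrder H.prime.pos).toSyn ((tatOrder H.prime.pos).degree (monomial I (1 : F))) := by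
    rw [hdeg, MonomialOrder.degree_lt_iff]
    · intro K hK
      rcases Finset.mem_union.mp (support_add hK) with hK | hK
      · rw [Finset.mem_singleton.mp (support_monomial_subset hK)]
        exact hJI
      · exact hPI K hK
    · rw [map_zero, ← MonomialOrder.bot_eq_zero, bot_lt_iff_ne_bot, MonomialOrder.bot_eq_zero, Ne,
        MonomialOrder.toSyn_eq_zero_iff]
      exact hI
  rw [sub_sub]
  refine ⟨?_, ?_, ?_, ?_⟩
  · rw [map_sub, map_add, h1, aeval_monomial_eq_powerProduct, aeval_monomial_eq_powerProduct, C_1]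
    ring
  · rw [MonomialOrder.degree_sub_of_lt hlt', hdeg]
  · rw [MonomialOrder.Monic, MonomialOrder.leadingCoeff_sub_of_lt hlt']
    simp
  · refine (isWeightedHomogeneous_monomial _ _ _ rfl).sub
      ((isWeightedHomogeneous_monomial _ _ _ hw).add (h3 _ (hwI.sub ?_)))
    rw [← hw]
    exact hwJ.C_mul c

theorem tat_degrees (p : ℕ) :
    (∑ i, (Finsupp.single 2 2 : Fin 5 →₀ ℕ) i • genDegree p i =
      ∑ i, (Finsupp.single 1 (p ^ 2) : Fin 5 →₀ ℕ) i • genDegree p i) ∧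
    (∑ i, (Finsupp.single 3 p : Fin 5 →₀ ℕ) i • genDegree p i =
      ∑ i, (Finsupp.single 1 1 + Finsupp.single 2 p : Fin 5 →₀ ℕ) i • genDegree p i) := by
  constructor
  · ext k
    fin_cases k
    · exact (sum_smul_genDegree p _).1.trans (Eq.trans (by simp) (sum_smul_genDegree p _).1.symm)
    · refine (sum_smul_genDegree p _).2.1.trans (Eq.trans ?_ (sum_smul_genDegree p _).2.1.symm)
      simp
      ring
    · exact (sum_smul_genDegree p _).2.2.trans (Eq.trans (by simp) (sum_smul_genDegree p _).2.2.symm)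
  · ext k
    fin_cases k
    · exact (sum_smul_genDegree p _).1.trans (Eq.trans (by simp) (sum_smul_genDegree p _).1.symm)
    · refine (sum_smul_genDegree p _).2.1.trans (Eq.trans ?_ (sum_smul_genDegree p _).2.1.symm)
      simp
      ring
    · exact (sum_smul_genDegree p _).2.2.trans (Eq.trans (by simp) (sum_smul_genDegree p _).2.2.symm)

theorem isNontrivialTat (H : IsGeneratorFamily p A h) {I J : Fin 5 →₀ ℕ}
    (hIJ : ∑ i, I i • genDegree p i = ∑ i, J i • genDegree p i) (hdisj : Disjoint I.support J.support) :
    IsNontrivialTat h I J := by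
  refine ⟨?_, hdisj⟩
  rw [leadMonomial, leadMonomial, H.degree_powerProduct, H.degree_powerProduct, hIJ]

/-! ### The ideal of relations and its regular sequence. -/

section Presentation

variable {r₁ r₂ : MvPolynomial (Fin 5) F} {m : MonomialOrder (Fin 5)}

/-- The remainder of a relation on division by r₁ and r₂ has only normal exponents and still maps to
0, so it is 0 because normal power products are linearly independent. -/
theorem ker_aeval (H : IsGeneratorFamily p A h) (h1 : aeval h r₁ = 0) (h2 : aeval h r₂ = 0)
    (d1 : m.degree r₁ = Finsupp.single 2 2) (d2 : m.degree r₂ = Finsupp.single 3 p)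
    (m1 : m.Monic r₁) (m2 : m.Monic r₂) :
    RingHom.ker (aeval h : MvPolynomial (Fin 5) F →ₐ[F] MvPolynomial (Fin 3) F) =
      Ideal.span {r₁, r₂} := by
  apply le_antisymm
  · intro f hf
    rw [RingHom.mem_ker] at hf
    obtain ⟨g, s, hfs, -, hs⟩ := m.div_set (B := {r₁, r₂}) (by
      rintro b (rfl | rfl)
      · rw [m1.leadingCoeff_eq_one]; exact isUnit_one
      · rw [m2.leadingCoeff_eq_one]; exact isUnit_one) f
    have hmem : Finsupp.linearCombination (MvPolynomial (Fin 5) F)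
        (fun b : ({r₁, r₂} : Set (MvPolynomial (Fin 5) F)) => (b : MvPolynomial (Fin 5) F)) g ∈
        Ideal.span {r₁, r₂} := by
      rw [Finsupp.linearCombination_apply, Finsupp.sum]
      exact sum_mem fun b _ => Ideal.mul_mem_left _ _ (Ideal.subset_span b.2)
    have hle : Ideal.span {r₁, r₂} ≤
        RingHom.ker (aeval h : MvPolynomial (Fin 5) F →ₐ[F] MvPolynomial (Fin 3) F) := by
      rw [Ideal.span_le]
      rintro b (rfl | rfl)
      · exact h1
      · exact h2
    have hs0 : aeval h s = 0 := by
      have := RingHom.mem_ker.mp (hle hmem)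
      rwa [hfs, map_add, this, zero_add] at hf
    have hs' : s = 0 := by
      by_contra hne
      refine (exists_degree_aeval h grevlex H.ne_zero H.injOn_degree hne ?_).choose_spec.2.2 hs0
      rw [mem_restrictSupport_iff F]
      intro I hI
      have e1 := hs I hI r₁ (Set.mem_insert _ _)
      have e2 := hs I hI r₂ (Set.mem_insert_of_mem _ rfl)
      rw [d1, Finsupp.single_le_iff, not_le] at e1
      rw [d2, Finsupp.single_le_iff, not_le] at e2
      exact ⟨e1, e2⟩
    rw [hfs, hs', add_zero]
    exact hmem
  · rw [Ideal.span_le]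
    rintro b (rfl | rfl)
    · exact h1
    · exact h2

open scoped Pointwise in
-- Suppose r₁ divides r₂f, and let s be the remainder of f modulo r₁; then r₁ divides r₂s. If s ≠ 0,
-- comparing exponents of X₂ in the leading monomials shows that X₂² divides that of s, since the
-- one of r₂ is X₃^p; but s is reduced. The ideal is proper because it is the kernel of a map to a
-- nonzero ring.
theorem isRegular_pair
    (hker : RingHom.ker (aeval h : MvPolynomial (Fin 5) F →ₐ[F] MvPolynomial (Fin 3) F) =
      Ideal.span {r₁, r₂})
    (d1 : m.degree r₁ = Finsupp.single 2 2) (d2 : m.degree r₂ = Finsupp.single 3 p)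
    (m1 : m.Monic r₁) (m2 : m.Monic r₂) :
    RingTheory.Sequence.IsRegular (MvPolynomial (Fin 5) F) [r₁, r₂] := by
  have hmem : ∀ f : MvPolynomial (Fin 5) F,
      f ∈ r₁ • (⊤ : Submodule (MvPolynomial (Fin 5) F) (MvPolynomial (Fin 5) F)) ↔ r₁ ∣ f := by
    intro f
    rw [Submodule.mem_smul_pointwise_iff_exists]
    constructor
    · rintro ⟨g, -, rfl⟩
      exact ⟨g, rfl⟩
    · rintro ⟨g, rfl⟩
      exact ⟨g, trivial, rfl⟩
  refine ⟨?_, ?_⟩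
  · rw [RingTheory.Sequence.isWeaklyRegular_cons_iff,
      RingTheory.Sequence.isWeaklyRegular_singleton_iff]
    refine ⟨fun f g hfg => mul_left_cancel₀ m1.ne_zero hfg, ?_⟩
    rw [isSMulRegular_quotient_iff_mem_of_smul_mem]
    intro f hf
    rw [hmem] at hf ⊢
    obtain ⟨g, s, hfs, -, hs⟩ := m.div_single (b := r₁)
      (by rw [m1.leadingCoeff_eq_one]; exact isUnit_one) f
    obtain ⟨t, ht⟩ := hf
    have hst : r₂ * s = r₁ * (t - r₂ * g) := by
      rw [smul_eq_mul, hfs] at ht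
      linear_combination ht
    by_cases hs0 : s = 0
    · rw [hfs, hs0, add_zero]
      exact dvd_mul_left _ _
    · exfalso
      have hne : r₁ * (t - r₂ * g) ≠ 0 := by
        rw [← hst]
        exact mul_ne_zero m2.ne_zero hs0
      have hd := congrArg m.degree hst
      rw [m.degree_mul m2.ne_zero hs0, m.degree_mul m1.ne_zero (right_ne_zero_of_mul hne), d1,
        d2] at hd
      refine hs _ (m.degree_mem_support hs0) ?_
      rw [d1, Finsupp.single_le_iff]
      have := DFunLike.congr_fun hd 2
      simp at this
      omega
  · intro htop
    have h1 : (1 : MvPolynomial (Fin 5) F) ∈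
        RingHom.ker (aeval h : MvPolynomial (Fin 5) F →ₐ[F] MvPolynomial (Fin 3) F) := by
      rw [hker]
      have : (1 : MvPolynomial (Fin 5) F) ∈ (⊤ : Ideal (MvPolynomial (Fin 5) F)) := trivial
      rw [htop, smul_eq_mul, Ideal.mul_top] at this
      rwa [Ideal.ofList_cons, Ideal.ofList_singleton, ← Ideal.span_insert] at this
    rw [RingHom.mem_ker, map_one] at h1
    exact one_ne_zero h1

theorem isCompleteIntersection (H : IsGeneratorFamily p A h)
    (hker : RingHom.ker (aeval h : MvPolynomial (Fin 5) F →ₐ[F] MvPolynomial (Fin 3) F) =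
      Ideal.span {r₁, r₂})
    (hreg : RingTheory.Sequence.IsRegular (MvPolynomial (Fin 5) F) [r₁, r₂]) :
    IsCompleteIntersection F A := by
  have hmem : ∀ P : MvPolynomial (Fin 5) F, aeval h P ∈ A := by
    intro P
    rw [← H.adjoin_eq, Algebra.adjoin_range_eq_range_aeval]
    exact ⟨P, rfl⟩
  refine ⟨5, (aeval h).codRestrict A hmem, [r₁, r₂], ?_, hreg, ?_⟩
  · rintro ⟨f, hf⟩
    obtain ⟨P, -, rfl⟩ := H.exists_normal hf
    exact ⟨P, rfl⟩
  · rw [Ideal.ofList_cons, Ideal.ofList_singleton, ← Ideal.span_insert, ← hker]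
    ext P
    rw [RingHom.mem_ker, RingHom.mem_ker]
    exact Subtype.ext_iff

end Presentation

end IsGeneratorFamily

/-! ### Lead monomials after setting x = 1. -/

section DegreeBounds

variable {F : Type*} [Field F]

/-- All monomials of `f` are smaller than the monomial with exponent `d` (or `f` is constant and
`d ≠ 0`). -/
def DegreeBelow (d : Fin 3 →₀ ℕ) (f : MvPolynomial (Fin 3) F) : Prop :=
  grevlex.toSyn (grevlex.degree f) < grevlex.toSyn d

theorem DegreeBelow.add {d : Fin 3 →₀ ℕ} {f g : MvPolynomial (Fin 3) F} (hf : DegreeBelow d f)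
    (hg : DegreeBelow d g) : DegreeBelow d (f + g) :=
  grevlex.degree_add_le.trans_lt (max_lt hf hg)

theorem DegreeBelow.neg {d : Fin 3 →₀ ℕ} {f : MvPolynomial (Fin 3) F} (hf : DegreeBelow d f) :
    DegreeBelow d (-f) := by
  rwa [DegreeBelow, MonomialOrder.degree_neg]

theorem DegreeBelow.C_mul {d : Fin 3 →₀ ℕ} {f : MvPolynomial (Fin 3) F} (hf : DegreeBelow d f)
    (c : F) : DegreeBelow d (C c * f) := by
  rw [DegreeBelow, C_mul']
  exact grevlex.degree_smul_le.trans_lt hf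

theorem DegreeBelow.of_degree {d : Fin 3 →₀ ℕ} {f : MvPolynomial (Fin 3) F} {e : Fin 3 →₀ ℕ}
    (hf : grevlex.degree f = e) (h : e 0 + e 1 + e 2 < d 0 + d 1 + d 2) : DegreeBelow d f := by
  rw [DegreeBelow, hf, grevlex_lt_iff]
  exact Or.inl h

theorem degree_X_pow (i : Fin 3) (n : ℕ) :
    grevlex.degree (X i ^ n : MvPolynomial (Fin 3) F) = Finsupp.single i n := by
  classical
  rw [X_pow_eq_monomial, MonomialOrder.degree_monomial, if_neg one_ne_zero]

theorem degree_add_of_degreeBelow {d : Fin 3 →₀ ℕ} {f g : MvPolynomial (Fin 3) F}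
    (hf : grevlex.degree f = d) (hg : DegreeBelow d g) : grevlex.degree (f + g) = d := by
  rw [MonomialOrder.degree_add_of_lt, hf]
  rwa [hf]

theorem degree_dehomog_addPolyA {p : ℕ} (h3 : 3 ≤ p) (hodd : Odd p) (α β ε : F) :
    grevlex.degree (dehomog (addPolyA p α β ε)) = Finsupp.single 0 p := by
  rw [dehomog_addPolyA hodd, add_assoc, add_assoc]
  refine degree_add_of_degreeBelow (by rw [MonomialOrder.degree_neg, degree_X_pow]) ?_
  refine DegreeBelow.add (DegreeBelow.C_mul ?_ α)
    (DegreeBelow.add (DegreeBelow.C_mul ?_ β) (DegreeBelow.C_mul ?_ ε))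
  -- The terms u^p and v^p have equal degree; the order ranks v above u.
  · rw [DegreeBelow, degree_X_pow, grevlex_lt_iff]
    simp
    omega
  · refine DegreeBelow.of_degree MonomialOrder.degree_X ?_
    simp
    omega
  · refine DegreeBelow.of_degree MonomialOrder.degree_X ?_
    simp
    omega

theorem degree_dehomog_addPolyB {p : ℕ} (h3 : 3 ≤ p) (a b c d : F) :
    grevlex.degree (dehomog (addPolyB p a b c d)) = Finsupp.single 1 (p ^ 3) := by
  obtain ⟨b1, b2⟩ := pow_bounds h3
  rw [dehomog_addPolyB, show (X 1 ^ p ^ 3 - C a * X 1 ^ p ^ 2 + C b * X 1 ^ p - C c * X 0 +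
      C d * X 1 : MvPolynomial (Fin 3) F) = X 1 ^ p ^ 3 + (-(C a * X 1 ^ p ^ 2) +
        (C b * X 1 ^ p + (-(C c * X 0) + C d * X 1))) by ring]
  refine degree_add_of_degreeBelow (degree_X_pow _ _) ?_
  refine ((DegreeBelow.C_mul ?_ a).neg).add ((DegreeBelow.C_mul ?_ b).add
    (((DegreeBelow.C_mul ?_ c).neg).add (DegreeBelow.C_mul ?_ d)))
  · refine DegreeBelow.of_degree (degree_X_pow _ _) ?_
    simp
    omega
  · refine DegreeBelow.of_degree (degree_X_pow _ _) ?_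
    simp
    omega
  · refine DegreeBelow.of_degree MonomialOrder.degree_X ?_
    simp
    omega
  · refine DegreeBelow.of_degree MonomialOrder.degree_X ?_
    simp
    omega

/-- With x = 1 the cancellation that defines h₃ is no longer at the top: the powers of h₁ have
degree at most p · p² = p³, so h₂² of degree 2p³ dominates. -/
theorem degree_dehomog_tatRemainder {p : ℕ} (h3 : 3 ≤ p) (hodd : Odd p) (α β ε a b c d : F) :
    grevlex.degree (dehomog (tatRemainder p a b (addPolyA p α β ε) (addPolyB p a b c d))) =
      Finsupp.single 1 (2 * p ^ 3) := by
  obtain ⟨b1, b2⟩ := pow_bounds h3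
  have hA := degree_dehomog_addPolyA h3 hodd α β ε
  have hB := degree_dehomog_addPolyB h3 a b c d
  rw [tatRemainder]
  generalize 2 * a = a'
  generalize 2 * b = b'
  simp only [map_add, map_sub, map_mul, map_pow, dehomog_X_two, dehomog_C, one_pow, mul_one]
  set H₁ := dehomog (addPolyA p α β ε)
  set H₂ := dehomog (addPolyB p a b c d)
  have hpow : ∀ n, n ≤ p ^ 2 → DegreeBelow (Finsupp.single 1 (2 * p ^ 3)) (H₁ ^ n) := by
    intro n hn
    refine DegreeBelow.of_degree (by rw [MonomialOrder.degree_pow, hA]) ?_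
    have : n * p ≤ p ^ 3 := by
      rw [pow_succ]
      exact Nat.mul_le_mul_right p hn
    simp
    omega
  rw [show H₂ ^ 2 - H₁ ^ p ^ 2 + C a' * H₁ ^ (p * (p + 1) / 2) -
      C b' * H₁ ^ ((p ^ 2 + 1) / 2) = H₂ ^ 2 + (-(H₁ ^ p ^ 2) +
        (C a' * H₁ ^ (p * (p + 1) / 2) + -(C b' * H₁ ^ ((p ^ 2 + 1) / 2)))) by ring]
  refine degree_add_of_degreeBelow ?_ ((hpow _ le_rfl).neg.add
    (((hpow _ ?_).C_mul _).add ((hpow _ ?_).C_mul _).neg))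
  · rw [MonomialOrder.degree_pow, hB, Finsupp.smul_single, smul_eq_mul]
  · rw [show p * (p + 1) = p ^ 2 + p by ring]
    omega
  · omega

variable {p : ℕ} [CharP F p] (M : Matrix (Fin 2) (Fin 4) F)

theorem degree_act_X_zero (e : Multiplicative (Fin 4 → ZMod p)) :
    grevlex.degree (act p M e (X 0)) = Finsupp.single 0 1 ∧ grevlex.Monic (act p M e (X 0)) := by
  have h2 : (2 : MvPolynomial (Fin 3) F) = C 2 := rfl
  have hX : grevlex.degree (X 0 : MvPolynomial (Fin 3) F) = Finsupp.single 0 1 :=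
    MonomialOrder.degree_X
  have hb : DegreeBelow (Finsupp.single 0 1) (C (2 * rowComb p M 0 e.toAdd) * X 1 +
      C (rowComb p M 0 e.toAdd ^ 2 + rowComb p M 1 e.toAdd) * X 2 : MvPolynomial (Fin 3) F) := by
    refine DegreeBelow.add (DegreeBelow.C_mul ?_ _) (DegreeBelow.C_mul ?_ _)
    · rw [DegreeBelow, MonomialOrder.degree_X, grevlex_lt_iff]
      simp
    · rw [DegreeBelow, MonomialOrder.degree_X, grevlex_lt_iff]
      simp
  rw [act_X_zero, h2, ← C_mul, ← C_pow, ← C_add, add_assoc]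
  refine ⟨degree_add_of_degreeBelow hX hb, ?_⟩
  rw [DegreeBelow, ← hX] at hb
  rw [MonomialOrder.Monic, MonomialOrder.leadingCoeff_add_of_lt hb, MonomialOrder.leadingCoeff_X]

/-- Here z becomes v + u², whose top term is u²; the translation terms have degree at most 1. -/
theorem degree_dehomog_act_X_zero (e : Multiplicative (Fin 4 → ZMod p)) :
    grevlex.degree (dehomog (act p M e (X 0))) = Finsupp.single 1 2 := by
  have h2 : (2 : MvPolynomial (Fin 3) F) = C 2 := rfl
  rw [act_X_zero, h2, ← C_mul, ← C_pow, ← C_add]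
  generalize 2 * rowComb p M 0 e.toAdd = s
  generalize rowComb p M 0 e.toAdd ^ 2 + rowComb p M 1 e.toAdd = t
  rw [map_add, map_add, map_mul, map_mul, dehomog_X_zero,
    dehomog_X_one, dehomog_X_two, dehomog_C, dehomog_C, add_comm (X 0), add_assoc, add_assoc]
  refine degree_add_of_degreeBelow (degree_X_pow _ _) (DegreeBelow.add ?_
    (DegreeBelow.add (DegreeBelow.C_mul ?_ _) (DegreeBelow.C_mul ?_ _)))
  · exact DegreeBelow.of_degree MonomialOrder.degree_X (by simp)
  · exact DegreeBelow.of_degree MonomialOrder.degree_X (by simp)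
  · exact DegreeBelow.of_degree MonomialOrder.degree_one (by simp)

theorem card_group [Fact p.Prime] : Fintype.card (Multiplicative (Fin 4 → ZMod p)) = p ^ 4 := by
  simp [ZMod.card]

end DegreeBounds

/-! ### Verification for x, h₁, h₂, h₃, N_M(z), and the theorem. -/

section GeneratorFamily

variable {F : Type*} [Field F] {p : ℕ} [Fact p.Prime] [CharP F p] (M : Matrix (Fin 2) (Fin 4) F)

theorem normM_X_zero_spec (h2 : (2 : F) ≠ 0)
    (hinj : ∀ a : Fin 4 → ZMod p, rowComb p M 0 a = 0 → rowComb p M 1 a = 0 → a = 0) :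
    (normM p M (X 0)).IsHomogeneous (p ^ 4) ∧ grevlex.Monic (normM p M (X 0)) ∧
    grevlex.degree (normM p M (X 0)) = Finsupp.single 0 (p ^ 4) ∧
    dehomog (normM p M (X 0)) ≠ 0 ∧
    grevlex.degree (dehomog (normM p M (X 0))) = Finsupp.single 1 (2 * p ^ 4) := by
  have hd : ∀ e : Multiplicative (Fin 4 → ZMod p), dehomog (act p M e (X 0)) ≠ 0 := by
    intro e
    refine grevlex.ne_zero_of_degree_ne_zero ?_
    rw [degree_dehomog_act_X_zero]
    simp
  rw [normM_X_zero M hinj h2, map_prod]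
  refine ⟨?_, ?_, ?_, Finset.prod_ne_zero_iff.mpr fun e _ => hd e, ?_⟩
  · have := IsHomogeneous.prod Finset.univ (fun e => act p M e (X 0)) (fun _ => 1)
      fun e _ => isHomogeneous_act M e (isHomogeneous_X F 0)
    rwa [Finset.sum_const, Finset.card_univ, card_group, smul_eq_mul, mul_one] at this
  · rw [MonomialOrder.Monic, MonomialOrder.leadingCoeff_prod_of_regular]
    · exact Finset.prod_eq_one fun e _ => (degree_act_X_zero M e).2.leadingCoeff_eq_one
    · intro e _
      rw [(degree_act_X_zero M e).2.leadingCoeff_eq_one]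
      exact isRegular_one
  · rw [MonomialOrder.degree_prod fun e _ => (degree_act_X_zero M e).2.ne_zero]
    simp only [degree_act_X_zero, Finset.sum_const, Finset.card_univ, card_group]
    simp
  · rw [MonomialOrder.degree_prod fun e _ => hd e]
    simp only [degree_dehomog_act_X_zero, Finset.sum_const, Finset.card_univ, card_group]
    simp [mul_comm]

variable {M} in
theorem generators_spec (hp : p ≠ 2) (h1234 : gam p M ![1, 2, 3, 4] = 0)
    (h1235 : gam p M ![1, 2, 3, 5] ≠ 0) (h1357 : gam p M ![1, 3, 5, 7] ≠ 0) :
    C (gam p M ![1, 2, 3, 5]) * X 2 ^ (p ^ 2 - 2 * p) * genH1 p M = fBar p M ![1, 2, 3, 4, 5] ∧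
    C (2 * gam p M ![1, 3, 5, 7]) * X 2 ^ (p ^ 3 - 2) * genH3 p M =
      C (gam p M ![1, 2, 3, 5]) * genH3Tilde p M ∧
    IsGeneratorFamily p (invariants p M) (gens p M) := by
  have hprime := (Fact.out : p.Prime)
  have hodd : Odd p := hprime.odd_of_ne_two hp
  have h3 : 3 ≤ p := by
    have := hprime.two_le
    omega
  obtain ⟨b1, b2⟩ := pow_bounds h3
  have h2 : (2 : F) ≠ 0 := by
    have := (CharP.cast_eq_zero_iff F p 2).not.mpr
      fun h => hp ((Nat.prime_dvd_prime_iff_eq hprime Nat.prime_two).mp h)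
    exact_mod_cast this
  have hinj := eq_zero_of_rowComb_eq_zero p M h1235
  have hrelA := addPolyA_relation M h1234 h1235
  have hrelB := addPolyB_relation M h1235
  have hA := fBar_12345 M h3 hodd h1234 h1235
  have hB := fBar_12357 M h3 h1235
  have hc : gam p M ![1, 3, 5, 7] / gam p M ![1, 2, 3, 5] ≠ 0 := div_ne_zero h1357 h1235
  have htilde : genH3Tilde p M = tatRemainder p (gam p M ![1, 2, 3, 7] / gam p M ![1, 2, 3, 5])
      (gam p M ![1, 2, 5, 7] / gam p M ![1, 2, 3, 5]) (genH1 p M) (genH2 p M) := rfl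
  have hg1 := congrArg (divXPow (p ^ 2 - 2 * p)) hA
  rw [divXPow_X_pow_mul] at hg1
  change genH1 p M = _ at hg1
  change genH2 p M = _ at hB
  have hk : gam p M ![1, 2, 3, 5] / (2 * gam p M ![1, 3, 5, 7]) =
      (2 * (gam p M ![1, 3, 5, 7] / gam p M ![1, 2, 3, 5]))⁻¹ := by
    field_simp
  have hγ : (C (gam p M ![1, 2, 3, 5]) * C (gam p M ![1, 2, 3, 5])⁻¹ : MvPolynomial (Fin 3) F) =
      1 := by rw [← C_mul, mul_inv_cancel₀ h1235, C_1]
  have hγ' : 2 * gam p M ![1, 3, 5, 7] = gam p M ![1, 2, 3, 5] *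
      (2 * (gam p M ![1, 3, 5, 7] / gam p M ![1, 2, 3, 5])) := by
    field_simp
  set α := gam p M ![1, 2, 4, 5] / gam p M ![1, 2, 3, 5]
  set β := -(gam p M ![1, 3, 4, 5] / gam p M ![1, 2, 3, 5])
  set ε := gam p M ![2, 3, 4, 5] / gam p M ![1, 2, 3, 5]
  set a := gam p M ![1, 2, 3, 7] / gam p M ![1, 2, 3, 5]
  set b := gam p M ![1, 2, 5, 7] / gam p M ![1, 2, 3, 5]
  set c := gam p M ![1, 3, 5, 7] / gam p M ![1, 2, 3, 5]
  set d := gam p M ![2, 3, 5, 7] / gam p M ![1, 2, 3, 5]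
  have h2c : 2 * c ≠ 0 := mul_ne_zero h2 hc
  obtain ⟨g, hg, hgdvd⟩ := exists_tatRemainder_eq h3 hodd α β ε a b d h2c
  have hg' : genH3Tilde p M = X 2 ^ (p ^ 3 - 2) * (C (2 * c) * g) := by
    rw [htilde, hg1, hB, hg]
  have hg3 : genH3 p M = g := by
    rw [genH3, hk, hg', mul_left_comm, divXPow_X_pow_mul, ← mul_assoc, ← C_mul,
      inv_mul_cancel₀ h2c, C_1, one_mul]
  have homA := isHomogeneous_addPolyA h3 α β ε
  have homB := isHomogeneous_addPolyB h3 a b c d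
  have invA := addPolyA_mem_invariants M h3 α β ε hrelA
  have invB := addPolyB_mem_invariants M h3 a b c d hrelB
  have hg_eq : g = C (2 * c)⁻¹ * (C (2 * c) * g) := by
    rw [← mul_assoc, ← C_mul, inv_mul_cancel₀ h2c, C_1, one_mul]
  have invg : g ∈ invariants p M := by
    rw [hg_eq]
    -- Invariance of h₃ is inherited from h̃₃, a polynomial in x, h₁, h₂, because x is fixed and can
    -- be cancelled.
    refine mul_mem (Subalgebra.algebraMap_mem _ _) (mem_invariants_of_X_pow_mul M ?_ (n := p ^ 3 - 2))
    have hX := X_two_mem_invariants (p := p) M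
    rw [← hg, tatRemainder]
    exact sub_mem (add_mem (sub_mem (pow_mem invB _) (pow_mem invA _))
      (mul_mem (mul_mem (Subalgebra.algebraMap_mem _ _) (pow_mem invA _)) (pow_mem hX _)))
      (mul_mem (mul_mem (Subalgebra.algebraMap_mem _ _) (pow_mem invA _)) (pow_mem hX _))
  have homg : g.IsHomogeneous (p ^ 3 + 2) := by
    rw [hg_eq]
    refine IsHomogeneous.C_mul (isHomogeneous_of_X_pow_mul (i := 2) (n := p ^ 3 - 2) ?_) _
    rw [← hg, show p ^ 3 - 2 + (p ^ 3 + 2) = p ^ 3 * 2 by omega]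
    obtain ⟨k, hk⟩ : ∃ k, p + 1 = 2 * k := by
      obtain ⟨m, hm⟩ := hodd
      exact ⟨m + 1, by omega⟩
    have e1 : 2 * p * (p * (p + 1) / 2) = p ^ 3 + p ^ 2 := by
      rw [hk, mul_left_comm p 2 k, Nat.mul_div_cancel_left _ two_pos,
        show 2 * p * (p * k) = p * p * (2 * k) by ring, ← hk]
      ring
    obtain ⟨l, hl⟩ : ∃ l, p ^ 2 + 1 = 2 * l := by
      obtain ⟨m, hm⟩ := hodd.pow (n := 2)
      exact ⟨m + 1, by omega⟩
    have e2 : 2 * p * ((p ^ 2 + 1) / 2) = p ^ 3 + p := by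
      rw [hl, Nat.mul_div_cancel_left _ two_pos, show 2 * p * l = p * (2 * l) by ring, ← hl]
      ring
    have t2 := ((homA.pow (p * (p + 1) / 2)).C_mul (2 * a)).mul
      (isHomogeneous_X_pow (R := F) 2 (p ^ 3 - p ^ 2))
    have t3 := ((homA.pow ((p ^ 2 + 1) / 2)).C_mul (2 * b)).mul
      (isHomogeneous_X_pow (R := F) 2 (p ^ 3 - p))
    have t1 := homA.pow (p ^ 2)
    rw [e1, show p ^ 3 + p ^ 2 + (p ^ 3 - p ^ 2) = p ^ 3 * 2 by omega] at t2
    rw [e2, show p ^ 3 + p + (p ^ 3 - p) = p ^ 3 * 2 by omega] at t3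
    rw [show 2 * p * p ^ 2 = p ^ 3 * 2 by ring] at t1
    exact (((homB.pow 2).sub t1).add t2).sub t3
  have dehg : C (2 * c) * dehomog g =
      dehomog (tatRemainder p a b (addPolyA p α β ε) (addPolyB p a b c d)) := by
    generalize 2 * c = k at hg
    rw [hg, map_mul, map_mul, map_pow, dehomog_X_two, one_pow, one_mul, dehomog_C]
  have degg := degree_dehomog_tatRemainder h3 hodd α β ε a b c d
  have dehg0 : dehomog g ≠ 0 := by
    intro h0
    rw [← dehg, h0, mul_zero, MonomialOrder.degree_zero] at degg
    have := DFunLike.congr_fun degg 1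
    simp at this
    omega
  rw [← dehg, MonomialOrder.degree_mul (C_ne_zero.mpr h2c) dehg0, MonomialOrder.degree_C,
    zero_add] at degg
  have degA := degree_dehomog_addPolyA h3 hodd α β ε
  have degB := degree_dehomog_addPolyB h3 a b c d
  have lmA : grevlex.degree (addPolyA p α β ε) = Finsupp.single 1 (2 * p) ∧
      grevlex.Monic (addPolyA p α β ε) := by
    refine grevlex_degree_eq_of_X_dvd homA ?_
    obtain ⟨s, hs⟩ := exists_addPolyA_eq h3 α β ε
    rw [hs, add_sub_cancel_left]
    exact (dvd_pow_self _ hprime.ne_zero).mul_right _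
  have lmB : grevlex.degree (addPolyB p a b c d) = Finsupp.single 1 (p ^ 3) ∧
      grevlex.Monic (addPolyB p a b c d) := by
    refine grevlex_degree_eq_of_X_dvd homB ?_
    obtain ⟨s, hs, -⟩ := exists_addPolyB_eq h3 a b c d
    rw [hs, add_sub_cancel_left]
    exact (dvd_pow_self _ (by omega)).mul_right _
  have lmg := grevlex_degree_eq_of_X_dvd homg hgdvd
  obtain ⟨homN, monN, degN, dehN0, dehN⟩ := normM_X_zero_spec M h2 hinj
  have hgens : gens p M = ![X 2, addPolyA p α β ε, addPolyB p a b c d, g, normM p M (X 0)] := by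
    rw [gens, hg1, hB, hg3]
  refine ⟨?_, ?_, ?_⟩
  · rw [hg1]
    linear_combination -C (gam p M ![1, 2, 3, 5]) * hA + fBar p M ![1, 2, 3, 4, 5] * hγ
  · rw [hg3, hg', hγ', C_mul]
    ring
  · rw [hgens]
    refine ⟨hprime, hodd, rfl, ?_, ?_, ?_, ?_, ?_, ?_, ?_, ?_⟩
    · intro i
      fin_cases i
      exacts [X_two_mem_invariants M, invA, invB, invg, normM_mem_invariants M _]
    · intro i
      fin_cases i
      exacts [isHomogeneous_X F 2, homA, homB, homg, homN]
    · intro i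
      fin_cases i
      exacts [MonomialOrder.leadingCoeff_X, lmA.2, lmB.2, lmg.2, monN]
    · intro i
      fin_cases i
      exacts [MonomialOrder.degree_X, lmA.1, lmB.1, lmg.1, degN]
    · have hne : ∀ (f : MvPolynomial (Fin 3) F) (i : Fin 3) (n : ℕ), n ≠ 0 →
          grevlex.degree f = Finsupp.single i n → f ≠ 0 := by
        intro f i n hn hf
        refine grevlex.ne_zero_of_degree_ne_zero ?_
        rw [hf]
        simpa using hn
      intro i
      fin_cases i
      · change dehomog (X 2) ≠ 0
        rw [dehomog_X_two]
        exact one_ne_zero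
      · exact hne _ _ _ hprime.ne_zero degA
      · exact hne _ _ _ (by omega) degB
      · exact dehg0
      · exact dehN0
    · intro i
      fin_cases i
      · change grevlex.degree (dehomog (X 2)) = 0
        rw [dehomog_X_two]
        exact MonomialOrder.degree_one
      exacts [degA, degB, degg, dehN]
    · exact fun f hf n => homogeneousComponent_mem_invariants M hf n
    · exact fun f hf => dehomog_mem_adjoin M hodd hc hrelA hrelB hinj hf

end GeneratorFamily

theorem mainTheorem3 {p : ℕ} [Fact p.Prime] (hp : p ≠ 2) {F : Type*} [Field F] [CharP F p]
    (M : Matrix (Fin 2) (Fin 4) F)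
    (h1234 : gam p M ![1, 2, 3, 4] = 0)
    (h1235 : gam p M ![1, 2, 3, 5] ≠ 0)
    (h1357 : gam p M ![1, 3, 5, 7] ≠ 0) :
    -- the divisions by powers of `x` in the definitions of `h₁` and `h₃` are exact
    C (gam p M ![1, 2, 3, 5]) * X 2 ^ (p ^ 2 - 2 * p) * genH1 p M = fBar p M ![1, 2, 3, 4, 5] ∧
    C (2 * gam p M ![1, 3, 5, 7]) * X 2 ^ (p ^ 3 - 2) * genH3 p M =
      C (gam p M ![1, 2, 3, 5]) * genH3Tilde p M ∧
    -- the degrees of the generators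
    (∀ i, gens p M i ≠ 0 ∧
      (gens p M i).IsHomogeneous ((![1, 2 * p, p ^ 3, p ^ 3 + 2, p ^ 4] : Fin 5 → ℕ) i)) ∧
    -- SAGBI basis, hence generating set
    IsSagbiBasis (Set.range (gens p M)) (invariants p M) ∧
    Algebra.adjoin F (Set.range (gens p M)) = invariants p M ∧
    -- complete intersection
    IsCompleteIntersection F (invariants p M) ∧
    -- the pairs `(h₂², h₁^(p²))` and `(h₃^p, h₁ h₂^p)` are têtes-à-têtes that subduct to zero
    IsNontrivialTat (gens p M) (Finsupp.single 2 2) (Finsupp.single 1 (p ^ 2)) ∧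
    IsNontrivialTat (gens p M) (Finsupp.single 3 p) (Finsupp.single 1 1 + Finsupp.single 2 p) ∧
    (∃ r, IsTatRelation (gens p M) (Finsupp.single 2 2) (Finsupp.single 1 (p ^ 2)) r) ∧
    (∃ r, IsTatRelation (gens p M) (Finsupp.single 3 p)
      (Finsupp.single 1 1 + Finsupp.single 2 p) r) ∧
    -- the relations from these subductions form a regular sequence generating all relations
    ∀ r₁ r₂ : MvPolynomial (Fin 5) F,
      IsTatRelation (gens p M) (Finsupp.single 2 2) (Finsupp.single 1 (p ^ 2)) r₁ →
      IsTatRelation (gens p M) (Finsupp.single 3 p)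
        (Finsupp.single 1 1 + Finsupp.single 2 p) r₂ →
      RingHom.ker (aeval (gens p M) : MvPolynomial (Fin 5) F →ₐ[F] MvPolynomial (Fin 3) F) =
        Ideal.span {r₁, r₂} ∧
      RingTheory.Sequence.IsRegular (MvPolynomial (Fin 5) F) [r₁, r₂] ∧
      r₁.IsWeightedHomogeneous (![1, 2 * p, p ^ 3, p ^ 3 + 2, p ^ 4] : Fin 5 → ℕ) (2 * p ^ 3) ∧
      r₂.IsWeightedHomogeneous (![1, 2 * p, p ^ 3, p ^ 3 + 2, p ^ 4] : Fin 5 → ℕ)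
        (p ^ 4 + 2 * p) := by
  obtain ⟨div1, div3, H⟩ := generators_spec hp h1234 h1235 h1357
  obtain ⟨t1, t2⟩ := IsGeneratorFamily.tat_degrees p
  have hprime := (Fact.out : p.Prime)
  have hpresent : ∀ r₁ r₂ : MvPolynomial (Fin 5) F,
      IsTatRelation (gens p M) (Finsupp.single 2 2) (Finsupp.single 1 (p ^ 2)) r₁ →
      IsTatRelation (gens p M) (Finsupp.single 3 p)
        (Finsupp.single 1 1 + Finsupp.single 2 p) r₂ →
      RingHom.ker (aeval (gens p M) : MvPolynomial (Fin 5) F →ₐ[F] MvPolynomial (Fin 3) F) =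
        Ideal.span {r₁, r₂} ∧
      RingTheory.Sequence.IsRegular (MvPolynomial (Fin 5) F) [r₁, r₂] ∧
      r₁.IsWeightedHomogeneous (genWeight p) (2 * p ^ 3) ∧
      r₂.IsWeightedHomogeneous (genWeight p) (p ^ 4 + 2 * p) := by
    intro r₁ r₂ hr₁ hr₂
    -- The tie-break: h₃ occurs in neither member of the first pair, so h₂² wins by its exponent of
    -- h₂; in the second pair h₃^p wins by its exponent of h₃.
    obtain ⟨k1, d1, m1, w1⟩ := H.tatRelation_spec (by simp) t1 (by simp) hr₁
    obtain ⟨k2, d2, m2, w2⟩ := H.tatRelation_spec (by simpa using hprime.ne_zero) t2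
      (by simpa using hprime.pos) hr₂
    have hker := H.ker_aeval k1 k2 d1 d2 m1 m2
    refine ⟨hker, IsGeneratorFamily.isRegular_pair hker d1 d2 m1 m2, ?_, ?_⟩
    · convert w1 using 1
      rw [Finsupp.weight_single]
      rfl
    · convert w2 using 1
      rw [Finsupp.weight_single]
      change _ = p * (p ^ 3 + 2)
      ring
  have ht1 := H.exists_isTatRelation t1
  have ht2 := H.exists_isTatRelation t2
  refine ⟨div1, div3, fun i => ⟨H.ne_zero i, H.homogeneous i⟩, H.isSagbiBasis, H.adjoin_eq, ?_,
    H.isNontrivialTat t1 ?_, H.isNontrivialTat t2 ?_, ht1, ht2, hpresent⟩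
  · obtain ⟨r₁, hr₁⟩ := ht1
    obtain ⟨r₂, hr₂⟩ := ht2
    obtain ⟨hker, hreg, -⟩ := hpresent r₁ r₂ hr₁ hr₂
    exact H.isCompleteIntersection hker hreg
  · rw [Finset.disjoint_left]
    intro i h1 h2
    rw [Finset.mem_singleton.mp (Finsupp.support_single_subset h1)] at h2
    simp at h2
  · rw [Finset.disjoint_left]
    intro i h1 h2
    rw [Finset.mem_singleton.mp (Finsupp.support_single_subset h1)] at h2
    simp at h2
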